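/- Let $c\ge 1$ be an integer, $\mu>0$, $\theta\ge 0$, and let $\lambda:[0,\infty)\to[0,\infty)$ be locally integrable. Let $Q=(Q(t))_{t\ge 0}$ be the queue length process of the $M(t)/M/c+M$ (non-stationary Erlang-A) queue with arrival rate $\lambda(t)$, $c$ servers, service rate $\mu$ and abandonment rate $\theta$, i.e. a right-continuous process with values in $\{0,1,2,\dots\}$ such that almost surely, for all $t\ge 0$, $$Q(t)=Q(0)+\Pi_1\Big(\int_0^t\lambda(s)\,ds\Big)-\Pi_2\Big(\int_0^t\mu\,(Q(s)\wedge c)\,ds\Big)-\Pi_3\Big(\int_0^t\theta\,(Q(s)-c)^+\,ds\Big),$$ where $\Pi_1,\Pi_2,\Pi_3$ are independent standard (rate 1) Poisson processes, independent of $Q(0)$, and $E[Q(0)]<\infty$ (for instance $Q(0)$ deterministic). Let $q$ be the fluid (mean-field) mean, i.e. a continuous function on $[0,\infty)$ that solves $$\dot q(t)=\lambda(t)-\mu\,(q(t)\wedge c)-\theta\,(q(t)-c)^+ ,\qquad q(0)=E[Q(0)],$$ in integrated form (at every $t$, if $\lambda$ is continuous). Then $E[Q(t)]<\infty$ for all $t\ge0$,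 and: * if $\theta<\mu$, then $E[Q(t)]\ge q(t)$ for all $t\ge 0$; * if $\theta>\mu$, then $E[Q(t)]\le q(t)$ for all $t\ge 0$; * if $\theta=\mu$, then $E[Q(t)]=q(t)$ for all $t\ge 0$. -/

import Mathlib

open MeasureTheory ProbabilityTheory
open scoped NNReal

/-- A standard (rate 1) Poisson process on `[0, ∞)`: it starts at `0`, its paths are nondecreasing
and right-continuous, its increments over disjoint intervals are independent, and
`N t - N s` has the Poisson law of mean `t - s` for `s ≤ t`.
Since the paths are nondecreasing, the subtraction of natural numbers does not truncate. -/
structure IsStandardPoissonProcess {Ω : Type*} [MeasurableSpace Ω] (P : Measure Ω)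
    (N : ℝ≥0 → Ω → ℕ) : Prop where
  measurable : ∀ t, Measurable (N t)
  zero : ∀ ω, N 0 ω = 0
  mono : ∀ ω, Monotone fun t => N t ω
  rightCts : ∀ ω t, ContinuousWithinAt (fun s => N s ω) (Set.Ici t) t
  indepIncrements : HasIndepIncrements N P
  law : ∀ s t : ℝ≥0, s ≤ t →
    HasLaw (fun ω => N t ω - N s ω) (poissonMeasure (t - s)) P

/-- The queue length process `Q` of the `M(t)/M/c+M` (non-stationary Erlang-A) queue with arrival
rate `lam`, `c` servers, service rate `μ` and abandonment rate `θ`: there are three independent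
standard Poisson processes `N 0, N 1, N 2`, independent of `Q 0`, such that almost surely, for all
`t ≥ 0`,
`Q t = Q 0 + N 0 (∫₀ᵗ lam s ds) - N 1 (∫₀ᵗ μ (Q s ∧ c) ds) - N 2 (∫₀ᵗ θ (Q s - c)⁺ ds)`. -/
structure IsErlangAQueue {Ω : Type*} [MeasurableSpace Ω] (P : Measure Ω)
    (lam : ℝ → ℝ) (c : ℕ) (μ θ : ℝ) (Q : ℝ≥0 → Ω → ℕ) : Prop where
  measurable : ∀ t, Measurable (Q t)
  rightCts : ∀ᵐ ω ∂P, ∀ t, ContinuousWithinAt (fun s => Q s ω) (Set.Ici t) t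
  timeChange : ∃ N : Fin 3 → ℝ≥0 → Ω → ℕ,
    (∀ i, IsStandardPoissonProcess P (N i)) ∧
    iIndepFun (fun i ω (t : ℝ≥0) => N i t ω) P ∧
    IndepFun (Q 0) (fun ω (i : Fin 3) (t : ℝ≥0) => N i t ω) P ∧
    ∀ᵐ ω ∂P, ∀ t : ℝ≥0,
      (Q t ω : ℝ) = (Q 0 ω : ℝ)
        + (N 0 (∫ s in (0 : ℝ)..t, lam s).toNNReal ω : ℝ)
        - (N 1 (∫ s in (0 : ℝ)..t, μ * min (Q s.toNNReal ω : ℝ) c).toNNReal ω : ℝ)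
        - (N 2 (∫ s in (0 : ℝ)..t, θ * max ((Q s.toNNReal ω : ℝ) - c) 0).toNNReal ω : ℝ)

/-- `q` solves on `[0, ∞)` the fluid (mean-field) equation
`q' = lam t - μ (q ∧ c) - θ (q - c)⁺`, in integrated form; for continuous `lam` this is the same
as the differential equation at every `t ≥ 0`. -/
structure IsFluidMean (lam : ℝ → ℝ) (c : ℕ) (μ θ : ℝ) (q : ℝ → ℝ) : Prop where
  continuousOn : ContinuousOn q (Set.Ici 0)
  integralEq : ∀ t : ℝ, 0 ≤ t →
    q t = q 0 + ∫ s in (0 : ℝ)..t, (lam s - μ * min (q s) c - θ * max (q s - c) 0)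

/-
Departure stream `i` is a Poisson process evaluated at its internal clock, and the event that the
clock has passed a level `a` is determined by the arrivals, the other streams and stream `i` up to
`a`; this holds because the queue is a pure jump process, built jump by jump from the streams. So
this event is independent of the later increments of stream `i`, and the expected number of
departures is the expected value of the clock. Hence the mean `m` of the queue length solves
`m t = m 0 + ∫₀ᵗ (lam s - E[D (Q s)]) ds`, where `D x = μ (x ∧ c) + θ (x - c)⁺` is concave for
`θ ≤ μ` and convex for `μ ≤ θ`. By Jensen's inequality, `E[D (Q s)] ≤ D (m s)` in the concave case
and the reverse holds in the convex case. As `D` is nondecreasing, the solution of the fluid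
equation therefore cannot cross `m`.
-/

open Filter Set TopologicalSpace Topology

section RightContinuous

variable {α β γ δ : Type*} [TopologicalSpace α] [Preorder α] [TopologicalSpace β]
  [TopologicalSpace γ] [Preorder γ] [TopologicalSpace δ]

/-- Right continuity. On a partially ordered space such as `ℝ≥0 × (ι → ℝ≥0)`, a point is approached
from all points above it. -/
def RightContinuous (f : α → β) : Prop :=
  ∀ a, ContinuousWithinAt f (Ici a) a

theorem RightContinuous.comp {f : α → β} (hf : RightContinuous f) {g : γ → α}
    (hg : Continuous g) (hmono : Monotone g) : RightContinuous fun c => f (g c) := fun c =>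
  (hf (g c)).comp hg.continuousWithinAt fun _ h => hmono h

theorem RightContinuous.map {f : α → β} (hf : RightContinuous f) {F : β → δ}
    (hF : Continuous F) : RightContinuous fun a => F (f a) := fun a =>
  hF.continuousAt.comp_continuousWithinAt (hf a)

theorem RightContinuous.prodMk {f : α → β} (hf : RightContinuous f) {g : α → δ}
    (hg : RightContinuous g) : RightContinuous fun a => (f a, g a) := fun a =>
  (hf a).prodMk (hg a)

theorem RightContinuous.eventually_eq [DiscreteTopology β] {f : α → β} (hf : RightContinuous f)
    (a : α) : ∀ᶠ b in 𝓝[≥] a, f b = f a := by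
  simpa only [ContinuousWithinAt, nhds_discrete, tendsto_pure] using hf a

theorem exists_rightContinuous_modification [Nonempty β] [MeasurableSpace β] {Ω : Type*}
    [MeasurableSpace Ω] {P : Measure Ω} {X : α → Ω → β} (hX : ∀ t, Measurable (X t))
    (hright : ∀ᵐ ω ∂P, RightContinuous (X · ω)) :
    ∃ Y : α → Ω → β, (∀ t, Measurable (Y t)) ∧ (∀ ω, RightContinuous (Y · ω)) ∧
      ∀ᵐ ω ∂P, ∀ t, Y t ω = X t ω := by
  classical
  obtain ⟨A, hA, hAm, hAright⟩ := hright.exists_measurable_mem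
  obtain ⟨b⟩ := ‹Nonempty β›
  refine ⟨fun t => A.piecewise (X t) fun _ => b, fun t => (hX t).piecewise hAm measurable_const,
    fun ω => ?_, ?_⟩
  · by_cases hω : ω ∈ A
    · simpa only [piecewise_eq_of_mem _ _ _ hω] using hAright ω hω
    · simp only [piecewise_eq_of_notMem _ _ _ hω]
      exact fun _ => continuousWithinAt_const
  · filter_upwards [hA] with ω hω t
    exact piecewise_eq_of_mem _ _ _ hω

end RightContinuous

section DwellTime

variable {E : Type*} {f f' : ℝ≥0 → E} {u r a : ℝ≥0}

/-- The time at which the path `f` first leaves its initial value, capped by `u`. -/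
noncomputable def dwellTime (f : ℝ≥0 → E) (u : ℝ≥0) : ℝ≥0 :=
  sInf (insert u {r | f r ≠ f 0})

theorem dwellTime_le : dwellTime f u ≤ u :=
  csInf_le (OrderBot.bddBelow _) (mem_insert _ _)

theorem dwellTime_lt_iff : dwellTime f u < a ↔ u < a ∨ ∃ r, f r ≠ f 0 ∧ r < a := by
  rw [dwellTime, csInf_lt_iff (OrderBot.bddBelow _) (insert_nonempty _ _)]
  simp only [mem_insert_iff, mem_ofPred_eq, or_and_right, exists_or, exists_eq_left]

theorem apply_eq_of_lt_dwellTime (h : r < dwellTime f u) : f r = f 0 := by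
  by_contra hne
  exact h.not_ge (csInf_le (OrderBot.bddBelow _) (Or.inr hne))

variable [TopologicalSpace E] [DiscreteTopology E]

theorem RightContinuous.dwellTime_eq_or_apply_ne (hf : RightContinuous f) :
    dwellTime f u = u ∨ f (dwellTime f u) ≠ f 0 := by
  have hfreq : ∃ᶠ r in 𝓝[≥] dwellTime f u, r ∈ insert u {r | f r ≠ f 0} :=
    (isGLB_csInf (insert_nonempty _ _) (OrderBot.bddBelow _)).frequently_mem (insert_nonempty _ _)
  refine or_iff_not_imp_left.2 fun hne heq => hfreq ?_
  have hlt : dwellTime f u < u := dwellTime_le.lt_of_ne hne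
  filter_upwards [hf.eventually_eq _, nhdsWithin_le_nhds (gt_mem_nhds hlt)] with r hr hru
  rintro (rfl | h)
  · exact lt_irrefl _ hru
  · exact h (hr.trans heq)

theorem RightContinuous.dwellTime_congr (hf : RightContinuous f)
    (h : ∀ r ≤ dwellTime f u, f' r = f r) : dwellTime f' u = dwellTime f u := by
  have h0 : f' 0 = f 0 := h 0 zero_le
  refine le_antisymm ?_ ?_
  · rcases hf.dwellTime_eq_or_apply_ne (u := u) with heq | hne
    · exact dwellTime_le.trans_eq heq.symm
    · exact csInf_le (OrderBot.bddBelow _) (Or.inr (by rwa [mem_ofPred_eq, h _ le_rfl, h0]))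
  · by_contra! hlt
    rcases dwellTime_lt_iff.1 hlt with hu | ⟨r, hne, hr⟩
    · exact hu.not_ge dwellTime_le
    · exact hne (by rw [h r hr.le, h0, apply_eq_of_lt_dwellTime hr])

theorem RightContinuous.dwellTime_lt_iff_denseSeq (hf : RightContinuous f) :
    dwellTime f u < a ↔
      u < a ∨ ∃ k, f (denseSeq ℝ≥0 k) ≠ f 0 ∧ denseSeq ℝ≥0 k < a := by
  rw [dwellTime_lt_iff]
  refine or_congr_right ⟨?_, fun ⟨k, hk⟩ => ⟨_, hk⟩⟩
  rintro ⟨r, hr, hra⟩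
  have hright : ∀ᶠ s in 𝓝[>] r, f s = f r ∧ s < a :=
    Eventually.and (nhdsWithin_mono r Ioi_subset_Ici_self (hf.eventually_eq r))
      (nhdsWithin_le_nhds (gt_mem_nhds hra))
  obtain ⟨b, hb, hsub⟩ := (mem_nhdsGT_iff_exists_Ioo_subset' hra).1 hright
  obtain ⟨k, hk⟩ := (denseRange_denseSeq ℝ≥0).exists_mem_open isOpen_Ioo (nonempty_Ioo.2 hb)
  exact ⟨k, by rwa [(hsub hk).1], (hsub hk).2⟩

theorem measurable_dwellTime {Ω : Type*} [MeasurableSpace Ω] [MeasurableSpace E]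
    [MeasurableEq E] {f : Ω → ℝ≥0 → E} {u : Ω → ℝ≥0}
    (hf : ∀ r, Measurable fun ω => f ω r)
    (hright : ∀ ω, RightContinuous (f ω)) (hu : Measurable u) :
    Measurable fun ω => dwellTime (f ω) (u ω) := by
  refine measurable_of_Iio fun a => ?_
  have hset : (fun ω => dwellTime (f ω) (u ω)) ⁻¹' Iio a = {ω | u ω < a} ∪
      ⋃ k, {ω | f ω (denseSeq ℝ≥0 k) = f ω 0}ᶜ ∩ {_ω | denseSeq ℝ≥0 k < a} := by
    ext ω
    simp [(hright ω).dwellTime_lt_iff_denseSeq]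
  rw [hset]
  exact (measurableSet_lt hu measurable_const).union <| MeasurableSet.iUnion fun k =>
    (measurableSet_eq_fun (hf _) (hf 0)).compl.inter (MeasurableSet.const _)

end DwellTime

section JumpChain

variable {ι E : Type*} {x x' : ℝ≥0 × (ι → ℝ≥0) → E} {v : E → ι → ℝ≥0} {u : ℝ≥0}

/-- The time and the internal clocks `r` units of time after `S`, if all clocks keep the speed
that belongs to the value `x S`. -/
def advance (x : ℝ≥0 × (ι → ℝ≥0) → E) (v : E → ι → ℝ≥0) (S : ℝ≥0 × (ι → ℝ≥0)) (r : ℝ≥0) :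
    ℝ≥0 × (ι → ℝ≥0) :=
  (S.1 + r, S.2 + r • v (x S))

/-- The times of the successive jumps of the value `x S`, capped by `u`, and the internal clocks at
these times, when clock `i` runs at speed `v (x S) i`. Once `u` is reached the chain stays put. -/
noncomputable def jumpChain (x : ℝ≥0 × (ι → ℝ≥0) → E) (v : E → ι → ℝ≥0) (u : ℝ≥0) :
    ℕ → ℝ≥0 × (ι → ℝ≥0)
  | 0 => 0
  | k + 1 =>
    let S := jumpChain x v u k
    advance x v S (dwellTime (fun r => x (advance x v S r)) (u - S.1))

@[simp]
theorem advance_zero (S : ℝ≥0 × (ι → ℝ≥0)) : advance x v S 0 = S := by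
  simp [advance]

theorem monotone_advance (S : ℝ≥0 × (ι → ℝ≥0)) : Monotone (advance x v S) := fun r r' h => by
  unfold advance
  gcongr

theorem continuous_advance (S : ℝ≥0 × (ι → ℝ≥0)) : Continuous (advance x v S) := by
  unfold advance
  fun_prop

theorem jumpChain_le_succ (k : ℕ) : jumpChain x v u k ≤ jumpChain x v u (k + 1) :=
  (advance_zero _).symm.le.trans (monotone_advance _ zero_le)

theorem jumpChain_fst_le (k : ℕ) : (jumpChain x v u k).1 ≤ u := by
  induction k with
  | zero => exact zero_le
  | succ k ih => exact (add_le_add_right dwellTime_le _).trans_eq (add_tsub_cancel_of_le ih)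

variable [TopologicalSpace E]

theorem RightContinuous.comp_advance (hx : RightContinuous x) (S : ℝ≥0 × (ι → ℝ≥0)) :
    RightContinuous fun r => x (advance x v S r) :=
  hx.comp (continuous_advance S) (monotone_advance S)

variable [DiscreteTopology E]

theorem RightContinuous.jumpChain_congr (hx : RightContinuous x) {k : ℕ}
    (h : ∀ S ≤ jumpChain x v u k, x' S = x S) : jumpChain x' v u k = jumpChain x v u k := by
  induction k with
  | zero => rfl
  | succ k ih =>
    set S := jumpChain x v u k
    have heq : ∀ r, advance x' v S r = advance x v S r := fun r => by
      simp only [advance, h S (jumpChain_le_succ k)]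
    simp only [jumpChain, ih fun T hT => h T (hT.trans (jumpChain_le_succ k)), heq]
    rw [(hx.comp_advance S).dwellTime_congr fun r hr => ?_]
    exact h _ (monotone_advance S hr)

theorem RightContinuous.apply_jumpChain_succ_ne (hx : RightContinuous x) {k : ℕ}
    (hlt : (jumpChain x v u (k + 1)).1 < u) :
    x (jumpChain x v u (k + 1)) ≠ x (jumpChain x v u k) := by
  rcases (hx.comp_advance (jumpChain x v u k)).dwellTime_eq_or_apply_ne
    (u := u - (jumpChain x v u k).1) with heq | hne
  · exact absurd ((congrArg _ heq).trans (add_tsub_cancel_of_le (jumpChain_fst_le k))) hlt.ne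
  · rwa [advance_zero] at hne

theorem measurable_jumpChain [MeasurableSpace E] [Countable E]
    [MeasurableSingletonClass E] {Ω : Type*} [MeasurableSpace Ω] {x : Ω → ℝ≥0 × (ι → ℝ≥0) → E}
    (hx : Measurable (Function.uncurry x)) (hright : ∀ ω, RightContinuous (x ω)) (k : ℕ) :
    Measurable fun ω => jumpChain (x ω) v u k := by
  induction k with
  | zero => exact measurable_const
  | succ k ih =>
    have hadvance : ∀ r : Ω → ℝ≥0, Measurable r →
        Measurable fun ω => advance (x ω) v (jumpChain (x ω) v u k) (r ω) := by
      intro r hr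
      have hvalue : Measurable fun ω => x ω (jumpChain (x ω) v u k) :=
        hx.comp (measurable_id.prodMk ih)
      have hspeed : ∀ i, Measurable fun ω => v (x ω (jumpChain (x ω) v u k)) i := fun i =>
        (measurable_of_countable fun y => v y i).comp hvalue
      exact (ih.fst.add hr).prodMk <| measurable_pi_lambda _ fun i =>
        (ih.snd.eval (a := i)).add (hr.mul (hspeed i))
    exact hadvance _ <| measurable_dwellTime
      (fun r => hx.comp (measurable_id.prodMk (hadvance _ measurable_const)))
      (fun ω => (hright ω).comp_advance _) (measurable_const.sub ih.fst)

end JumpChain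

/-- `τ` solves the random time change equation `τ i s = ∫₀ˢ v (x (r, τ r)) i dr` along a path
`s ↦ x (s, τ s)`. As that path is to be piecewise constant, the equation is only asked for on the
intervals where the path is constant. -/
structure IsTimeChange {ι E : Type*} [TopologicalSpace E] (x : ℝ≥0 × (ι → ℝ≥0) → E)
    (v : E → ι → ℝ≥0) (τ : ℝ≥0 → ι → ℝ≥0) : Prop where
  zero : τ 0 = 0
  mono : Monotone τ
  rightContinuous : RightContinuous fun s => x (s, τ s)
  add_of_constant : ∀ s r, (∀ d < r, x (s + d, τ (s + d)) = x (s, τ s)) →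
    τ (s + r) = τ s + r • v (x (s, τ s))

namespace IsTimeChange

variable {ι E : Type*} [TopologicalSpace E] {x x' : ℝ≥0 × (ι → ℝ≥0) → E} {v : E → ι → ℝ≥0}
  {τ : ℝ≥0 → ι → ℝ≥0} {F : ℝ≥0 → ℕ} {u : ℝ≥0}

theorem advance_eq (h : IsTimeChange x v τ) {s r : ℝ≥0}
    (hr : r ≤ dwellTime (fun d => x (s + d, τ (s + d))) u) :
    advance x v (s, τ s) r = (s + r, τ (s + r)) := by
  rw [advance, h.add_of_constant s r fun d hd => ?_]
  simpa only [add_zero] using apply_eq_of_lt_dwellTime (hd.trans_le hr)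

variable [DiscreteTopology E]

theorem dwellTime_advance_eq (h : IsTimeChange x v τ) (s : ℝ≥0) :
    dwellTime (fun r => x (advance x v (s, τ s) r)) u =
      dwellTime (fun r => x (s + r, τ (s + r))) u :=
  have hright : RightContinuous fun r => x (s + r, τ (s + r)) :=
    h.rightContinuous.comp (continuous_const_add s) (fun _ _ hr => by gcongr)
  hright.dwellTime_congr fun r hr => by rw [h.advance_eq hr]

theorem jumpChain_eq (h : IsTimeChange x v τ) (k : ℕ) :
    jumpChain x v u k = ((jumpChain x v u k).1, τ (jumpChain x v u k).1) := by
  induction k with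
  | zero => exact Prod.ext rfl h.zero.symm
  | succ k ih =>
    set s := (jumpChain x v u k).1
    have hsucc : jumpChain x v u (k + 1) =
        advance x v (s, τ s) (dwellTime (fun r => x (advance x v (s, τ s) r)) (u - s)) := by
      rw [jumpChain, ih]
    rw [hsucc, h.dwellTime_advance_eq, h.advance_eq le_rfl]

theorem exists_jumpChain_eq (h : IsTimeChange x v τ) (hx : RightContinuous x) (hF : Monotone F)
    (hconst : ∀ s r, F s = F r → x (s, τ s) = x (r, τ r)) :
    ∃ k, jumpChain x v u k = (u, τ u) := by
  by_contra! hne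
  have hlt : ∀ k, (jumpChain x v u k).1 < u := fun k =>
    (jumpChain_fst_le k).lt_of_ne fun heq => hne k (by rw [h.jumpChain_eq k, heq])
  have hmono : StrictMono fun k => F (jumpChain x v u k).1 := by
    refine strictMono_nat_of_lt_succ fun k =>
      (hF (jumpChain_le_succ k).1).lt_of_ne fun heq => hx.apply_jumpChain_succ_ne (hlt (k + 1)) ?_
    rw [h.jumpChain_eq k, h.jumpChain_eq (k + 1)]
    exact (hconst _ _ heq).symm
  have hbound : F (jumpChain x v u (F u + 1)).1 ≤ F u := hF (hlt _).le
  exact (hmono.le_apply.trans hbound).not_gt (Nat.lt_succ_self _)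

theorem lt_apply_iff (h : IsTimeChange x v τ) (hx : RightContinuous x) (hx' : RightContinuous x')
    (hF : Monotone F) (hconst : ∀ s r, F s = F r → x (s, τ s) = x (r, τ r)) {i : ι} {a : ℝ≥0}
    (hxx' : ∀ S, S.2 i ≤ a → x' S = x S) :
    a < τ u i ↔ ∃ k, a < (jumpChain x' v u k).2 i := by
  have hstopped : ∀ k,
      a < (jumpChain x' v u k).2 i ↔ a < (jumpChain x v u k).2 i := fun k => by
    rw [← not_le, ← not_le, not_iff_not]
    constructor <;> intro hk
    · rwa [hx'.jumpChain_congr fun S hS => (hxx' S ((hS.2 i).trans hk)).symm]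
    · rwa [hx.jumpChain_congr fun S hS => hxx' S ((hS.2 i).trans hk)]
  simp only [hstopped]
  constructor
  · intro ha
    obtain ⟨k, hk⟩ := h.exists_jumpChain_eq (u := u) hx hF hconst
    exact ⟨k, by rwa [hk]⟩
  · rintro ⟨k, hk⟩
    rw [h.jumpChain_eq k] at hk
    exact hk.trans_le (h.mono (jumpChain_fst_le k) i)

end IsTimeChange

section GridAbove

/-- The first point of the grid of mesh `1 / (n + 1)` that is not before `s`. -/
noncomputable def gridAbove (n : ℕ) (s : ℝ≥0) : ℝ≥0 :=
  ⌈((n : ℝ≥0) + 1) * s⌉₊ / (n + 1)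

theorem le_gridAbove (n : ℕ) (s : ℝ≥0) : s ≤ gridAbove n s := by
  rw [gridAbove, le_div_iff₀ (by positivity), mul_comm]
  exact Nat.le_ceil _

theorem gridAbove_le_add (n : ℕ) (s : ℝ≥0) : gridAbove n s ≤ s + 1 / (n + 1) := by
  rw [gridAbove, div_le_iff₀ (by positivity), add_mul s, one_div_mul_cancel (by positivity),
    mul_comm s]
  exact (Nat.ceil_lt_add_one zero_le).le

theorem gridAbove_le_add_one (n : ℕ) (s : ℝ≥0) : gridAbove n s ≤ s + 1 :=
  (gridAbove_le_add n s).trans <| by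
    gcongr
    exact div_le_one_of_le₀ (le_add_of_nonneg_left zero_le) zero_le

theorem tendsto_gridAbove (s : ℝ≥0) : Tendsto (fun n => gridAbove n s) atTop (𝓝[≥] s) := by
  refine tendsto_nhdsWithin_iff.2 ⟨?_, Eventually.of_forall fun n => le_gridAbove n s⟩
  refine tendsto_of_tendsto_of_tendsto_of_le_of_le tendsto_const_nhds ?_
    (fun n => le_gridAbove n s) (fun n => gridAbove_le_add n s)
  simpa using (tendsto_one_div_add_atTop_nhds_zero_nat (𝕜 := ℝ≥0)).const_add s

theorem measurable_gridAbove (n : ℕ) : Measurable (gridAbove n) :=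
  ((measurable_of_countable fun k : ℕ => (k : ℝ≥0)).comp
    (Nat.measurable_ceil.comp (measurable_const_mul _))).div_const _

theorem measurable_uncurry_of_rightContinuous {Ω E : Type*} [MeasurableSpace Ω]
    [TopologicalSpace E] [PseudoMetrizableSpace E] [MeasurableSpace E] [BorelSpace E]
    {X : Ω → ℝ≥0 → E} (hX : ∀ s, Measurable fun ω => X ω s)
    (hright : ∀ ω, RightContinuous (X ω)) : Measurable (Function.uncurry X) := by
  have hgrid : ∀ n, Measurable fun p : Ω × ℝ≥0 => X p.1 (gridAbove n p.2) := fun n => by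
    have hceil : Measurable fun p : Ω × ℝ≥0 => ⌈((n : ℝ≥0) + 1) * p.2⌉₊ :=
      Nat.measurable_ceil.comp (measurable_snd.const_mul _)
    exact (measurable_from_prod_countable_left (f := fun p : Ω × ℕ => X p.1 (p.2 / (n + 1)))
      fun k => hX (k / (n + 1))).comp (measurable_fst.prodMk hceil)
  refine measurable_of_tendsto_metrizable hgrid (tendsto_pi_nhds.2 fun p => ?_)
  exact (hright p.1 p.2).tendsto.comp (tendsto_gridAbove p.2)

end GridAbove

section PoissonProcess

open scoped Nat in
theorem hasSum_poisson_mean (r : ℝ≥0) :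
    HasSum (fun n : ℕ => Real.exp (-r) * r ^ n / n ! * (n : ℝ)) r := by
  have hshift : ∀ n : ℕ, Real.exp (-r) * (r : ℝ) ^ (n + 1) / (n + 1)! * ((n + 1 : ℕ) : ℝ) =
      r * (Real.exp (-r) * r ^ n / n !) := fun n => by
    rw [Nat.factorial_succ]
    push_cast
    field_simp
    ring
  rw [← hasSum_nat_add_iff' 1]
  simpa only [hshift, Finset.range_one, Finset.sum_singleton, Nat.cast_zero, mul_zero, sub_zero,
    mul_one] using (hasSum_one_poissonMeasure r).mul_left (r : ℝ)

theorem lintegral_natCast_poissonMeasure (r : ℝ≥0) :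
    ∫⁻ n : ℕ, (n : ENNReal) ∂(poissonMeasure r) = r := by
  have hint : Integrable (fun n : ℕ => (n : ℝ)) (poissonMeasure r) :=
    integrable_poissonMeasure_iff.2 (by simpa using (hasSum_poisson_mean r).summable)
  have hmean : ∫ n : ℕ, (n : ℝ) ∂(poissonMeasure r) = r :=
    (hasSum_integral_poissonMeasure hint).unique (by simpa using hasSum_poisson_mean r)
  simpa [hmean] using
    (ofReal_integral_eq_lintegral_ofReal hint (Eventually.of_forall fun n => n.cast_nonneg)).symm

theorem tsum_ite_lt_tsub {F : ℕ → ℝ≥0} (hF : Monotone F) (h0 : F 0 = 0) (K : ℕ) :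
    ∑' k, (if k < K then ((F (k + 1) - F k : ℝ≥0) : ENNReal) else 0) = F K := by
  rw [tsum_eq_sum (s := Finset.range K) fun k hk => if_neg (by simpa using hk),
    Finset.sum_congr rfl fun k hk => if_pos (Finset.mem_range.1 hk),
    ← ENNReal.ofNNReal_finsetSum, Finset.sum_range_tsub hF, h0, tsub_zero]

variable {Ω : Type*} [MeasurableSpace Ω] {P : Measure Ω} {N : ℝ≥0 → Ω → ℕ} {τ : Ω → ℝ≥0}

/-- For every `a`, the event `a < τ` is independent of the increments of `N` after time `a`. This
is all the optional sampling identity for `N` at `τ` needs; no filtration is involved. -/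
def IndepLaterIncrements (P : Measure Ω) (N : ℝ≥0 → Ω → ℕ) (τ : Ω → ℝ≥0) : Prop :=
  ∀ a b, a ≤ b → IndepFun (fun ω => a < τ ω) (fun ω => N b ω - N a ω) P

theorem IndepLaterIncrements.min_const [IsProbabilityMeasure P] (hτ : IndepLaterIncrements P N τ)
    (M : ℝ≥0) : IndepLaterIncrements P N fun ω => min (τ ω) M := fun a b hab => by
  by_cases hM : a < M
  · simpa only [lt_min_iff, hM, and_true] using hτ a b hab
  · simpa only [lt_min_iff, hM, and_false] using indepFun_const_left False _

namespace IsStandardPoissonProcess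

theorem rightContinuous (hN : IsStandardPoissonProcess P N) (ω : Ω) :
    RightContinuous fun s => N s ω :=
  hN.rightCts ω

theorem lintegral_increment (hN : IsStandardPoissonProcess P N) {s t : ℝ≥0} (h : s ≤ t) :
    ∫⁻ ω, ((N t ω - N s ω : ℕ) : ENNReal) ∂P = (t - s : ℝ≥0) := by
  rw [(hN.law s t h).lintegral_comp (f := fun n : ℕ => (n : ENNReal))
    (measurable_of_countable _).aemeasurable, lintegral_natCast_poissonMeasure]

theorem lintegral_eval_const (hN : IsStandardPoissonProcess P N) (t : ℝ≥0) :
    ∫⁻ ω, (N t ω : ENNReal) ∂P = t := by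
  simpa [hN.zero] using hN.lintegral_increment (zero_le (a := t))

theorem lintegral_ite_lt_increment (hN : IsStandardPoissonProcess P N) (hτm : AEMeasurable τ P)
    (hτ : IndepLaterIncrements P N τ) {a b : ℝ≥0} (hab : a ≤ b) :
    ∫⁻ ω, (if a < τ ω then ((N b ω - N a ω : ℕ) : ENNReal) else 0) ∂P =
      ∫⁻ ω, (if a < τ ω then ((b - a : ℝ≥0) : ENNReal) else 0) ∂P := by
  classical
  have hind : Measurable fun p : Prop => if p then (1 : ENNReal) else 0 := measurable_of_countable _
  have hcast : Measurable fun n : ℕ => (n : ENNReal) := measurable_of_countable _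
  have hevent : AEMeasurable (fun ω => if a < τ ω then (1 : ENNReal) else 0) P :=
    (Measurable.ite measurableSet_Ioi measurable_const measurable_const).comp_aemeasurable hτm
  have hincr : AEMeasurable (fun ω => ((N b ω - N a ω : ℕ) : ENNReal)) P :=
    (hcast.comp ((hN.measurable b).sub (hN.measurable a))).aemeasurable
  have hmul := lintegral_mul_eq_lintegral_mul_lintegral_of_indepFun'' hevent hincr
    ((hτ a b hab).comp hind hcast)
  rw [hN.lintegral_increment hab, ← lintegral_mul_const'' _ hevent] at hmul
  simpa only [Pi.mul_apply, ite_mul, one_mul, zero_mul] using hmul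

theorem lintegral_eval_gridAbove (hN : IsStandardPoissonProcess P N) (hτm : AEMeasurable τ P)
    (hτ : IndepLaterIncrements P N τ) (n : ℕ) :
    ∫⁻ ω, (N (gridAbove n (τ ω)) ω : ENNReal) ∂P = ∫⁻ ω, (gridAbove n (τ ω) : ENNReal) ∂P := by
  set p : ℕ → ℝ≥0 := fun k => k / (n + 1) with hp
  have hp0 : p 0 = 0 := by simp [hp]
  have hpm : Monotone p := fun i j hij => by simp only [hp]; gcongr
  have hlt : ∀ k s, k < ⌈((n : ℝ≥0) + 1) * s⌉₊ ↔ p k < s := fun k s => by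
    rw [Nat.lt_ceil, hp, div_lt_iff₀ (by positivity), mul_comm]
  have hN_sum : ∀ ω, (N (gridAbove n (τ ω)) ω : ENNReal) =
      ∑' k, if p k < τ ω then ((N (p (k + 1)) ω - N (p k) ω : ℕ) : ENNReal) else 0 := fun ω => by
    have hsum := tsum_ite_lt_tsub (F := fun k => N (p k) ω)
      (fun i j hij => Nat.cast_le.2 (hN.mono ω (hpm hij))) (by simp [hp0, hN.zero])
      ⌈((n : ℝ≥0) + 1) * τ ω⌉₊
    simp only [hlt, ← Nat.cast_tsub, ENNReal.coe_natCast] at hsum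
    exact hsum.symm
  have hgrid_sum : ∀ ω, (gridAbove n (τ ω) : ENNReal) =
      ∑' k, if p k < τ ω then ((p (k + 1) - p k : ℝ≥0) : ENNReal) else 0 := fun ω => by
    have hsum := tsum_ite_lt_tsub hpm hp0 ⌈((n : ℝ≥0) + 1) * τ ω⌉₊
    simp only [hlt] at hsum
    exact hsum.symm
  have hincr : ∀ k, Measurable fun ω => ((N (p (k + 1)) ω - N (p k) ω : ℕ) : ENNReal) := fun k =>
    (measurable_of_countable fun n : ℕ => (n : ENNReal)).comp
      ((hN.measurable _).sub (hN.measurable _))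
  have hmeas : ∀ (k : ℕ) {f : Ω → ENNReal}, Measurable f →
      AEMeasurable (fun ω => if p k < τ ω then f ω else 0) P := fun k f hf =>
    hf.aemeasurable.indicator₀ (hτm.nullMeasurableSet_preimage measurableSet_Ioi)
  simp only [hN_sum, hgrid_sum]
  rw [lintegral_tsum fun k => hmeas k (hincr k), lintegral_tsum fun k => hmeas k measurable_const]
  exact tsum_congr fun k => hN.lintegral_ite_lt_increment hτm hτ (hpm k.le_succ)

theorem aemeasurable_eval (hN : IsStandardPoissonProcess P N) (hτm : AEMeasurable τ P) :
    AEMeasurable (fun ω => N (τ ω) ω) P :=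
  (measurable_uncurry_of_rightContinuous (X := fun ω s => N s ω) hN.measurable
    hN.rightContinuous).comp_aemeasurable (aemeasurable_id.prodMk hτm)

theorem lintegral_eval_of_le [IsProbabilityMeasure P] (hN : IsStandardPoissonProcess P N)
    (hτm : AEMeasurable τ P) (hτ : IndepLaterIncrements P N τ) {M : ℝ≥0} (hM : ∀ ω, τ ω ≤ M) :
    ∫⁻ ω, (N (τ ω) ω : ENNReal) ∂P = ∫⁻ ω, (τ ω : ENNReal) ∂P := by
  have hgridm : ∀ n, AEMeasurable (fun ω => gridAbove n (τ ω)) P := fun n =>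
    (measurable_gridAbove n).comp_aemeasurable hτm
  have hgrid : ∀ n ω, gridAbove n (τ ω) ≤ M + 1 := fun n ω =>
    (gridAbove_le_add_one n _).trans (by gcongr; exact hM ω)
  have hN_lim : Tendsto (fun n => ∫⁻ ω, (N (gridAbove n (τ ω)) ω : ENNReal) ∂P) atTop
      (𝓝 (∫⁻ ω, (N (τ ω) ω : ENNReal) ∂P)) :=
    tendsto_lintegral_of_dominated_convergence' (fun ω => (N (M + 1) ω : ENNReal))
      (fun n => (measurable_of_countable _).comp_aemeasurable (hN.aemeasurable_eval (hgridm n)))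
      (fun n => Eventually.of_forall fun ω => Nat.cast_le.2 (hN.mono ω (hgrid n ω)))
      (by simp [hN.lintegral_eval_const])
      (Eventually.of_forall fun ω => ((hN.rightContinuous ω).map
        (continuous_of_discreteTopology (f := fun n : ℕ => (n : ENNReal))) (τ ω)).tendsto.comp
          (tendsto_gridAbove (τ ω)))
  have hτ_lim : Tendsto (fun n => ∫⁻ ω, (gridAbove n (τ ω) : ENNReal) ∂P) atTop
      (𝓝 (∫⁻ ω, (τ ω : ENNReal) ∂P)) :=
    tendsto_lintegral_of_dominated_convergence' (fun _ => ((M + 1 : ℝ≥0) : ENNReal))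
      (fun n => (hgridm n).coe_nnreal_ennreal)
      (fun n => Eventually.of_forall fun ω => ENNReal.coe_le_coe.2 (hgrid n ω))
      (by simp)
      (Eventually.of_forall fun ω => ENNReal.tendsto_coe.2
        ((tendsto_gridAbove (τ ω)).mono_right nhdsWithin_le_nhds))
  simp only [hN.lintegral_eval_gridAbove hτm hτ] at hN_lim
  exact tendsto_nhds_unique hN_lim hτ_lim

theorem lintegral_eval [IsProbabilityMeasure P] (hN : IsStandardPoissonProcess P N)
    (hτm : AEMeasurable τ P) (hτ : IndepLaterIncrements P N τ) :
    ∫⁻ ω, (N (τ ω) ω : ENNReal) ∂P = ∫⁻ ω, (τ ω : ENNReal) ∂P := by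
  have htrunc : ∀ n : ℕ, AEMeasurable (fun ω => min (τ ω) n) P := fun n =>
    hτm.min aemeasurable_const
  have hlim : ∀ {f : ℕ → Ω → ENNReal} {F : Ω → ENNReal}, (∀ n, AEMeasurable (f n) P) →
      (∀ ω, Monotone fun n => f n ω) → (∀ ω (n : ℕ), τ ω ≤ n → f n ω = F ω) →
      Tendsto (fun n => ∫⁻ ω, f n ω ∂P) atTop (𝓝 (∫⁻ ω, F ω ∂P)) := fun hf hmono hF =>
    lintegral_tendsto_of_tendsto_of_monotone hf (Eventually.of_forall hmono) <|
      Eventually.of_forall fun ω => tendsto_const_nhds.congr' <| by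
        filter_upwards [eventually_ge_atTop ⌈τ ω⌉₊] with n hn
        exact (hF ω n (Nat.ceil_le.1 hn)).symm
  have hmono : ∀ ω, Monotone fun n : ℕ => min (τ ω) n := fun ω i j hij => by
    dsimp only
    gcongr
  have hN_lim := hlim (f := fun n ω => (N (min (τ ω) n) ω : ENNReal))
    (F := fun ω => (N (τ ω) ω : ENNReal))
    (fun n => (measurable_of_countable _).comp_aemeasurable (hN.aemeasurable_eval (htrunc n)))
    (fun ω i j hij => Nat.cast_le.2 (hN.mono ω (hmono ω hij)))
    (fun ω n hn => by rw [min_eq_left hn])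
  have hτ_lim := hlim (f := fun n ω => ((min (τ ω) n : ℝ≥0) : ENNReal))
    (F := fun ω => (τ ω : ENNReal))
    (fun n => (htrunc n).coe_nnreal_ennreal)
    (fun ω i j hij => ENNReal.coe_le_coe.2 (hmono ω hij))
    (fun ω n hn => by rw [min_eq_left hn])
  have htrunc_eq : ∀ n : ℕ, ∫⁻ ω, (N (min (τ ω) n) ω : ENNReal) ∂P =
      ∫⁻ ω, ((min (τ ω) n : ℝ≥0) : ENNReal) ∂P := fun n =>
    hN.lintegral_eval_of_le (htrunc n) (hτ.min_const n) fun ω => min_le_right _ _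
  simp only [htrunc_eq] at hN_lim
  exact tendsto_nhds_unique hN_lim hτ_lim

end IsStandardPoissonProcess

end PoissonProcess

section Independence

variable {Ω : Type*} [MeasurableSpace Ω] {P : Measure Ω}

theorem indepFun_prodMk_left_of_prodMk_right [IsProbabilityMeasure P] {α β γ : Type*}
    [MeasurableSpace α] [MeasurableSpace β] [MeasurableSpace γ] {X : Ω → α} {U : Ω → β} {V : Ω → γ}
    (hX : Measurable X) (hU : Measurable U) (hV : Measurable V)
    (h : IndepFun X (fun ω => (U ω, V ω)) P) (h' : IndepFun U V P) :
    IndepFun (fun ω => (X ω, U ω)) V P := by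
  have hXU : IndepFun X U P := h.comp measurable_id measurable_fst
  have := Measure.isProbabilityMeasure_map (μ := P) hX.aemeasurable
  have := Measure.isProbabilityMeasure_map (μ := P) hU.aemeasurable
  have := Measure.isProbabilityMeasure_map (μ := P) hV.aemeasurable
  rw [indepFun_iff_map_prod_eq_prod_map_map (by fun_prop) (by fun_prop)] at h h' hXU ⊢
  have hassoc : P.map (fun ω => ((X ω, U ω), V ω)) =
      (P.map fun ω => (X ω, U ω, V ω)).map MeasurableEquiv.prodAssoc.symm := by
    rw [Measure.map_map (MeasurableEquiv.measurable _) (by fun_prop)]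
    rfl
  rw [hassoc, h, h', hXU, ← Measure.prodAssoc_prod,
    Measure.map_map (MeasurableEquiv.measurable _) (MeasurableEquiv.measurable _),
    MeasurableEquiv.symm_comp_self, Measure.map_id]

theorem exists_monotone_range_eq {α : Type*} [LinearOrder α] {J : Finset α} (hJ : J.Nonempty) :
    ∃ t : ℕ → α, Monotone t ∧ range t = J := by
  obtain ⟨K, hK⟩ := Nat.exists_eq_succ_of_ne_zero hJ.card_ne_zero
  refine ⟨fun k => J.orderEmbOfFin hK ⟨min k K, by lia⟩, fun i j hij => ?_, ?_⟩
  · exact (J.orderEmbOfFin hK).monotone (Fin.mk_le_mk.2 (by gcongr))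
  · rw [← J.range_orderEmbOfFin hK]
    refine (range_comp_subset_range (fun k => (⟨min k K, by lia⟩ : Fin (K + 1)))
      (J.orderEmbOfFin hK)).antisymm ?_
    rintro _ ⟨⟨k, hk⟩, rfl⟩
    exact ⟨k, congrArg (J.orderEmbOfFin hK) (Fin.ext (min_eq_left (Nat.lt_succ_iff.1 hk)))⟩

namespace IsStandardPoissonProcess

variable {N : ℝ≥0 → Ω → ℕ} {a b : ℝ≥0}

theorem indepFun_sequence_increment (hN : IsStandardPoissonProcess P N) {t : ℕ → ℝ≥0}
    (ht : Monotone t) (h0 : t 0 = 0) {k l : ℕ} (hkl : k ≤ l) :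
    IndepFun (fun ω j => N (t (min j k)) ω) (fun ω => N (t l) ω - N (t k) ω) P := by
  classical
  have hpath : ∀ ω, Monotone fun j => N (t j) ω := fun ω => (hN.mono ω).comp ht
  have hind := (hN.indepIncrements.nat ht).indepFun_finset (Finset.range k) (Finset.Ico k l)
    (Finset.disjoint_left.2 fun i hi hi' => by
      rw [Finset.mem_range] at hi
      exact hi.not_ge (Finset.mem_Ico.1 hi').1)
    fun i => (hN.measurable _).sub (hN.measurable _)
  let past (d : Finset.range k → ℕ) (j : ℕ) : ℕ :=
    ∑ i : Finset.range k, if (i : ℕ) < j then d i else 0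
  have hpast : Measurable past := measurable_pi_lambda _ fun j =>
    Finset.measurable_sum _ fun i _ => by split_ifs <;> fun_prop
  convert hind.comp hpast (ψ := fun d => ∑ i, d i) (by fun_prop) using 1
  · funext ω j
    simp only [past, Function.comp_apply]
    rw [Finset.sum_coe_sort (Finset.range k)
      (fun i => if i < j then N (t (i + 1)) ω - N (t i) ω else 0), ← Finset.sum_filter,
      show (Finset.range k).filter (· < j) = Finset.range (min j k) by ext; simp [and_comm],
      Finset.sum_range_tsub (hpath ω), h0, hN.zero, tsub_zero]
  · funext ω
    simp only [Function.comp_apply]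
    rw [Finset.sum_coe_sort (Finset.Ico k l) (fun i => N (t (i + 1)) ω - N (t i) ω),
      Finset.sum_Ico_eq_sum_range]
    exact ((Finset.sum_range_tsub (f := fun j => N (t (k + j)) ω)
      (fun i j hij => hpath ω (by gcongr)) (l - k)).trans (by simp [hkl])).symm

theorem indepFun_past_increment [IsProbabilityMeasure P] (hN : IsStandardPoissonProcess P N)
    (hab : a ≤ b) :
    IndepFun (fun ω s => N (min s a) ω) (fun ω => N b ω - N a ω) P := by
  refine IndepFun.process_indepFun (X := fun s ω => N (min s a) ω) (fun s => hN.measurable _)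
    ((hN.measurable b).sub (hN.measurable a)) fun I => ?_
  obtain ⟨t, ht, hrange⟩ := exists_monotone_range_eq
    (J := insert 0 (insert a (insert b (I.image (min · a))))) (Finset.insert_nonempty _ _)
  have hmem : ∀ s ∈ insert 0 (insert a (insert b (I.image (min · a)))), ∃ j, t j = s :=
    fun s hs => by rwa [← mem_range, hrange]
  obtain ⟨k, hk⟩ := hmem a (by simp)
  obtain ⟨l, hl⟩ := hmem b (by simp)
  have h0 : t 0 = 0 := by
    obtain ⟨j, hj⟩ := hmem 0 (by simp)
    exact nonpos_iff_eq_zero.1 ((ht (Nat.zero_le j)).trans_eq hj)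
  choose j hj using fun s : I => hmem (min s a) (by simp; grind)
  have hind := (hN.indepFun_sequence_increment ht h0 (le_max_left k l)).comp
    (φ := fun x (s : I) => x (j s)) (by fun_prop) measurable_id
  simpa [Function.comp_def, ht.map_min, ht.map_max, hj, hk, hl, hab] using hind

end IsStandardPoissonProcess

theorem indepFun_stopped_increment [IsProbabilityMeasure P] {ι α : Type*} [Finite ι]
    [DecidableEq ι] [MeasurableSpace α] {N : ι → ℝ≥0 → Ω → ℕ} {X : Ω → α}
    (hN : ∀ i, IsStandardPoissonProcess P (N i))
    (hind : iIndepFun (fun i ω t => N i t ω) P) (hX : Measurable X)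
    (hXN : IndepFun X (fun ω i t => N i t ω) P) (i : ι) {a b : ℝ≥0} (hab : a ≤ b) :
    IndepFun (fun ω => (X ω, fun j t => N j (if j = i then min t a else t) ω))
      (fun ω => N i b ω - N i a ω) P := by
  have := Fintype.ofFinite ι
  have hpath : ∀ j, Measurable fun ω t => N j t ω := fun j =>
    measurable_pi_lambda _ fun t => (hN j).measurable t
  have hincr : Measurable fun ω => N i b ω - N i a ω :=
    ((hN i).measurable b).sub ((hN i).measurable a)
  have hpast : Measurable fun ω s => N i (min s a) ω :=
    measurable_pi_lambda _ fun s => (hN i).measurable _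
  have hrest : Measurable fun ω (j : ({i}ᶜ : Finset ι)) t => N j t ω :=
    measurable_pi_lambda _ fun j => hpath j
  have hothers : IndepFun (fun ω (j : ({i}ᶜ : Finset ι)) t => N j t ω)
      (fun ω => ((fun s => N i (min s a) ω), N i b ω - N i a ω)) P :=
    (hind.indepFun_finset {i}ᶜ {i} disjoint_compl_left hpath).comp measurable_id
      (ψ := fun F : ({i} : Finset ι) → ℝ≥0 → ℕ =>
        ((fun s => F ⟨i, by simp⟩ (min s a)), F ⟨i, by simp⟩ b - F ⟨i, by simp⟩ a))
      (by fun_prop)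
  have hstopped : IndepFun (fun ω => ((fun (j : ({i}ᶜ : Finset ι)) t => N j t ω),
      fun s => N i (min s a) ω)) (fun ω => N i b ω - N i a ω) P :=
    indepFun_prodMk_left_of_prodMk_right hrest hpast hincr hothers
      ((hN i).indepFun_past_increment hab)
  have hpair := indepFun_prodMk_left_of_prodMk_right hX (hrest.prodMk hpast) hincr
    (hXN.comp measurable_id (ψ := fun F : ι → ℝ≥0 → ℕ =>
      (((fun (j : ({i}ᶜ : Finset ι)) t => F j t), fun s => F i (min s a)), F i b - F i a))
      (by fun_prop)) hstopped
  let merge (w : α × (({i}ᶜ : Finset ι) → ℝ≥0 → ℕ) × (ℝ≥0 → ℕ)) : α × (ι → ℝ≥0 → ℕ) :=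
    (w.1, fun j => if h : j = i then w.2.2 else w.2.1 ⟨j, by simpa using h⟩)
  have hmerge : Measurable merge := measurable_fst.prodMk <| measurable_pi_lambda _ fun j => by
    split_ifs <;> fun_prop
  refine (hpair.comp hmerge measurable_id).congr (.of_forall fun ω => ?_) .rfl
  refine Prod.ext rfl (funext fun j => ?_)
  by_cases h : j = i <;> simp [merge, h]

end Independence

section InternalClock

variable {ι : Type*} {v : ℕ → ι → ℝ≥0} {g q : ℝ≥0 → ℕ} {n : ι → ℝ≥0 → ℕ}

/-- The internal clocks along the path `q`: clock `i` runs at speed `v x i` while `q` has the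
value `x`. The path is integrated over the half-open interval `[0, t)`, so that the clocks at time
`t` only depend on the path before `t`. -/
noncomputable def internalClock (v : ℕ → ι → ℝ≥0) (q : ℝ≥0 → ℕ) (t : ℝ≥0) (i : ι) : ℝ≥0 :=
  (∫⁻ s in Ico (0 : ℝ) t, (v (q s.toNNReal) i : ENNReal)).toNNReal

theorem toNNReal_integral_eq_internalClock (hq : RightContinuous q) (t : ℝ≥0) (i : ι) :
    (∫ s in (0 : ℝ)..t, (v (q s.toNNReal) i : ℝ)).toNNReal = internalClock v q t i := by
  have hqm : Measurable q :=
    (measurable_uncurry_of_rightContinuous (Ω := Unit) (X := fun _ => q)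
      (fun _ => measurable_const) fun _ => hq).comp (measurable_prodMk_left (x := ()))
  have hrate : Measurable fun s : ℝ => (v (q s.toNNReal) i : ENNReal) :=
    ((measurable_of_countable fun x => v x i).comp
      (hqm.comp measurable_real_toNNReal)).coe_nnreal_ennreal
  rw [intervalIntegral.integral_of_le t.coe_nonneg, ← restrict_Ico_eq_restrict_Ioc, internalClock,
    ← ENNReal.toNNReal_toReal_eq, ← integral_toReal hrate.aemeasurable (by simp)]
  simp only [ENNReal.coe_toReal]

theorem coe_internalClock (hg : Monotone g) (hq : q ≤ g) (t : ℝ≥0) (i : ι) :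
    (internalClock v q t i : ENNReal) = ∫⁻ s in Ico (0 : ℝ) t, (v (q s.toNNReal) i : ENNReal) := by
  refine ENNReal.coe_toNNReal (setLIntegral_lt_top_of_le_nnreal (by simp)
    ⟨∑ x ∈ Finset.range (g t + 1), v x i, fun s hs => ENNReal.coe_le_coe.2 ?_⟩).ne
  have hle : q s.toNNReal ≤ g t :=
    (hq _).trans (hg (Real.toNNReal_le_iff_le_coe.2 hs.2.le))
  exact Finset.single_le_sum (f := fun x => v x i) (fun _ _ => zero_le)
    (Finset.mem_range_succ_iff.2 hle)

theorem monotone_internalClock (hg : Monotone g) (hq : q ≤ g) : Monotone (internalClock v q) :=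
  fun s t hst i => by
    rw [← ENNReal.coe_le_coe, coe_internalClock hg hq, coe_internalClock hg hq]
    exact lintegral_mono_set (Ico_subset_Ico_right (by exact_mod_cast hst))

theorem internalClock_add_of_constant (hg : Monotone g) (hq : q ≤ g) {s r : ℝ≥0}
    (hconst : ∀ d < r, q (s + d) = q s) :
    internalClock v q (s + r) = internalClock v q s + r • v (q s) := by
  funext i
  have hsplit : Ico (0 : ℝ) (s + r : ℝ≥0) = Ico 0 (s : ℝ) ∪ Ico (s : ℝ) (s + r : ℝ≥0) :=
    (Ico_union_Ico_eq_Ico s.coe_nonneg (by simp)).symm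
  have hvalue : ∀ x ∈ Ico (s : ℝ) (s + r : ℝ≥0), q x.toNNReal = q s := fun x hx => by
    have hsx : s ≤ x.toNNReal := NNReal.le_toNNReal_of_coe_le hx.1
    have hxr : x.toNNReal < s + r := (Real.toNNReal_lt_iff_lt_coe (s.coe_nonneg.trans hx.1)).2 hx.2
    rw [← add_tsub_cancel_of_le hsx]
    exact hconst _ ((tsub_lt_iff_left hsx).2 hxr)
  have hlast : ∫⁻ x in Ico (s : ℝ) (s + r : ℝ≥0), (v (q x.toNNReal) i : ENNReal) =
      (r * v (q s) i : ℝ≥0) := by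
    rw [setLIntegral_congr_fun measurableSet_Ico (g := fun _ => (v (q s) i : ENNReal))
      fun x hx => by simp only [hvalue x hx]]
    simp [mul_comm]
  rw [Pi.add_apply, Pi.smul_apply, smul_eq_mul, ← ENNReal.coe_inj, ENNReal.coe_add,
    coe_internalClock hg hq, coe_internalClock hg hq, hsplit,
    lintegral_union measurableSet_Ico Ico_disjoint_Ico_same, hlast]

variable [Fintype ι]

/-- The value of a queue at the time `S.1` and the internal clocks `S.2`, if `g` counts the
customers that have been in the queue and `n i` counts the departures of type `i` in the time of
its clock. -/
def queueValue (g : ℝ≥0 → ℕ) (n : ι → ℝ≥0 → ℕ) (S : ℝ≥0 × (ι → ℝ≥0)) : ℕ :=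
  g S.1 - ∑ i, n i (S.2 i)

theorem rightContinuous_queueValue (hg : RightContinuous g) (hn : ∀ i, RightContinuous (n i)) :
    RightContinuous (queueValue g n) := by
  have hdepart : RightContinuous fun S : ℝ≥0 × (ι → ℝ≥0) => ∑ i, n i (S.2 i) := fun S =>
    tendsto_finsetSum _ fun i _ =>
      (hn i).comp (by fun_prop : Continuous fun S : ℝ≥0 × (ι → ℝ≥0) => S.2 i)
        ((Function.monotone_eval i).comp monotone_snd) S
  exact ((hg.comp continuous_fst monotone_fst).prodMk hdepart).map
    (F := fun p : ℕ × ℕ => p.1 - p.2) continuous_of_discreteTopology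

theorem measurable_uncurry_queueValue {Ω : Type*} [MeasurableSpace Ω] {g : Ω → ℝ≥0 → ℕ}
    {n : Ω → ι → ℝ≥0 → ℕ} (hg : ∀ t, Measurable fun ω => g ω t)
    (hn : ∀ i t, Measurable fun ω => n ω i t) (hgright : ∀ ω, RightContinuous (g ω))
    (hnright : ∀ ω i, RightContinuous (n ω i)) :
    Measurable (Function.uncurry fun ω => queueValue (g ω) (n ω)) := by
  have hg' := measurable_uncurry_of_rightContinuous hg hgright
  have hn' := fun i => measurable_uncurry_of_rightContinuous (hn i) (hnright · i)
  have htime : Measurable fun p : Ω × ℝ≥0 × (ι → ℝ≥0) => (p.1, p.2.1) := by fun_prop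
  have hclock : ∀ i, Measurable fun p : Ω × ℝ≥0 × (ι → ℝ≥0) => (p.1, p.2.2 i) := fun i => by
    fun_prop
  exact (hg'.comp htime).sub
    (Finset.measurable_sum _ fun i _ => (hn' i).comp (hclock i))

/-- The path `q` solves the time changed balance equation: together with the departures up to the
internal clocks along `q`, the present customers make up all customers. -/
def SolvesBalance (g : ℝ≥0 → ℕ) (n : ι → ℝ≥0 → ℕ) (v : ℕ → ι → ℝ≥0) (q : ℝ≥0 → ℕ) : Prop :=
  ∀ t, q t + ∑ i, n i (internalClock v q t i) = g t

namespace SolvesBalance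

theorem le (h : SolvesBalance g n v q) : q ≤ g := fun t => (Nat.le_add_right _ _).trans_eq (h t)

theorem queueValue_eq (h : SolvesBalance g n v q) (t : ℝ≥0) :
    queueValue g n (t, internalClock v q t) = q t := by
  rw [queueValue, ← h t, Nat.add_sub_cancel]

theorem isTimeChange (h : SolvesBalance g n v q) (hg : Monotone g) (hq : RightContinuous q) :
    IsTimeChange (queueValue g n) v (internalClock v q) where
  zero := funext fun i => by simp [internalClock]
  mono := monotone_internalClock hg h.le
  rightContinuous := by simpa only [h.queueValue_eq] using hq
  add_of_constant s r hconst := by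
    simp only [h.queueValue_eq] at hconst ⊢
    exact internalClock_add_of_constant hg h.le hconst

theorem monotone_departures (h : SolvesBalance g n v q) (hg : Monotone g)
    (hn : ∀ i, Monotone (n i)) : Monotone fun t => ∑ i, n i (internalClock v q t i) :=
  fun _ _ hst => Finset.sum_le_sum fun i _ => hn i (monotone_internalClock hg h.le hst i)

theorem lt_internalClock_iff [DecidableEq ι] (h : SolvesBalance g n v q) (hg : Monotone g)
    (hgright : RightContinuous g) (hn : ∀ i, Monotone (n i)) (hnright : ∀ i, RightContinuous (n i))
    (hq : RightContinuous q) {i : ι} {a t : ℝ≥0} :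
    a < internalClock v q t i ↔ ∃ k, a < (jumpChain
      (queueValue g fun j s => n j (if j = i then min s a else s)) v t k).2 i := by
  have hmono := h.monotone_departures hg hn
  refine (h.isTimeChange hg hq).lt_apply_iff (rightContinuous_queueValue hgright hnright)
    (rightContinuous_queueValue hgright fun j => (hnright j).comp ?_ ?_)
    (F := fun s => g s + ∑ j, n j (internalClock v q s j)) (hg.add hmono) (fun s r hsr => ?_)
    fun S hS => ?_
  · split_ifs <;> fun_prop
  · intro s r hsr
    dsimp only
    split_ifs <;> gcongr
  · have hs := h s
    have hr := h r
    rw [h.queueValue_eq, h.queueValue_eq]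
    rcases le_total s r with hle | hle <;> grind [hg hle, hmono hle]
  · refine congrArg (g S.1 - ·) (Finset.sum_congr rfl fun j _ => ?_)
    dsimp only
    split_ifs with hj
    · subst hj
      rw [min_eq_left hS]
    · rfl

end SolvesBalance

end InternalClock

section TimeChangedQueue

variable {Ω ι : Type*} [Fintype ι] {v : ℕ → ι → ℝ≥0}

theorem measurable_exists_lt_jumpChain {mΩ : MeasurableSpace Ω} {g : Ω → ℝ≥0 → ℕ}
    {n : Ω → ι → ℝ≥0 → ℕ} (hg : ∀ t, Measurable fun ω => g ω t)
    (hn : ∀ i t, Measurable fun ω => n ω i t) (hgright : ∀ ω, RightContinuous (g ω))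
    (hnright : ∀ ω i, RightContinuous (n ω i)) (t a : ℝ≥0) (i : ι) :
    Measurable fun ω => ∃ k, a < (jumpChain (queueValue (g ω) (n ω)) v t k).2 i := by
  refine Measurable.exists fun k => measurableSet_setOfPred.1 <|
    measurableSet_lt measurable_const ?_
  exact (measurable_jumpChain (measurable_uncurry_queueValue hg hn hgright hnright)
    (fun ω => rightContinuous_queueValue (hgright ω) (hnright ω)) k).snd.eval

/-- A queue driven by random time changes: `g` counts the customers that have been in the queue, and
departures of type `i` occur at the rate `v x i` while the queue length is `x`, namely at the jumps
of the Poisson process `N i` in the time of its internal clock. -/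
structure IsTimeChangedQueue [MeasurableSpace Ω] (P : Measure Ω) (g : ℝ≥0 → Ω → ℕ)
    (N : ι → ℝ≥0 → Ω → ℕ) (v : ℕ → ι → ℝ≥0) (Q : ℝ≥0 → Ω → ℕ) : Prop where
  poisson : ∀ i, IsStandardPoissonProcess P (N i)
  iIndepFun_streams : iIndepFun (fun i ω t => N i t ω) P
  measurable_input : ∀ t, Measurable (g t)
  monotone_input : ∀ ω, Monotone (g · ω)
  rightContinuous_input : ∀ ω, RightContinuous (g · ω)
  indepFun_input : IndepFun (fun ω t => g t ω) (fun ω i t => N i t ω) P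
  measurable : ∀ t, Measurable (Q t)
  rightContinuous : ∀ ω, RightContinuous (Q · ω)
  balance : ∀ᵐ ω ∂P, SolvesBalance (g · ω) (fun i => (N i · ω)) v (Q · ω)

/-- The total rate of departures at the queue length `x`. -/
def totalRate (v : ℕ → ι → ℝ≥0) (x : ℕ) : ℝ≥0 := ∑ i, v x i

namespace IsTimeChangedQueue

variable [MeasurableSpace Ω] {P : Measure Ω} {g Q : ℝ≥0 → Ω → ℕ} {N : ι → ℝ≥0 → Ω → ℕ}

-- Up to its level `a`, clock `i` can be computed from the input and from the streams with stream
-- `i` stopped at `a`, so the event that it passes `a` cannot see the later increments of that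
-- stream.
theorem indepLaterIncrements_internalClock [IsProbabilityMeasure P]
    (h : IsTimeChangedQueue P g N v Q) (t : ℝ≥0) (i : ι) :
    IndepLaterIncrements P (N i) fun ω => internalClock v (Q · ω) t i := by
  classical
  intro a b hab
  let W (ω : Ω) : (ℝ≥0 → ℕ) × (ι → ℝ≥0 → ℕ) :=
    ((g · ω), fun j s => N j (if j = i then min s a else s) ω)
  have hW : IndepFun W (fun ω => N i b ω - N i a ω) P :=
    indepFun_stopped_increment h.poisson h.iIndepFun_streams
      (measurable_pi_lambda _ h.measurable_input) h.indepFun_input i hab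
  have hstopped : ∀ ω j, RightContinuous ((W ω).2 j) := fun ω j =>
    ((h.poisson j).rightContinuous ω).comp (by split_ifs <;> fun_prop) fun s r hsr => by
      split_ifs <;> gcongr
  have hpast : Measurable[MeasurableSpace.comap W inferInstance]
      fun ω => ∃ k, a < (jumpChain (queueValue (W ω).1 (W ω).2) v t k).2 i :=
    measurable_exists_lt_jumpChain
      (fun s => (measurable_pi_apply s).comp (measurable_fst.comp (comap_measurable W)))
      (fun j s => (measurable_pi_apply s).comp <| (measurable_pi_apply j).comp <|
        measurable_snd.comp (comap_measurable W))
      h.rightContinuous_input hstopped t a i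
  have hindep : IndepFun (fun ω => ∃ k, a < (jumpChain (queueValue (W ω).1 (W ω).2) v t k).2 i)
      (fun ω => N i b ω - N i a ω) P :=
    indep_of_indep_of_le_left hW hpast.comap_le
  refine hindep.congr ?_ .rfl
  filter_upwards [h.balance] with ω hω
  exact propext (hω.lt_internalClock_iff (h.monotone_input ω) (h.rightContinuous_input ω)
    (fun j => (h.poisson j).mono ω) (fun j => (h.poisson j).rightContinuous ω)
    (h.rightContinuous ω)).symm

theorem measurable_uncurry_rate (h : IsTimeChangedQueue P g N v Q) (i : ι) :
    Measurable fun p : ℝ × Ω => v (Q p.1.toNNReal p.2) i :=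
  (measurable_of_countable fun x => v x i).comp <|
    (measurable_uncurry_of_rightContinuous h.measurable h.rightContinuous).comp
      (by fun_prop : Measurable fun p : ℝ × Ω => (p.2, p.1.toNNReal))

theorem measurable_uncurry_totalRate (h : IsTimeChangedQueue P g N v Q) :
    Measurable fun p : ℝ × Ω => totalRate v (Q p.1.toNNReal p.2) :=
  Finset.measurable_sum _ fun i _ => h.measurable_uncurry_rate i

theorem measurable_internalClock (h : IsTimeChangedQueue P g N v Q) (t : ℝ≥0) (i : ι) :
    Measurable fun ω => internalClock v (Q · ω) t i :=
  (h.measurable_uncurry_rate i).coe_nnreal_ennreal.lintegral_prod_left'.ennreal_toNNReal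

theorem lintegral_departures [IsProbabilityMeasure P] (h : IsTimeChangedQueue P g N v Q)
    (t : ℝ≥0) (i : ι) :
    ∫⁻ ω, (N i (internalClock v (Q · ω) t i) ω : ENNReal) ∂P =
      ∫⁻ s in Ico (0 : ℝ) t, ∫⁻ ω, (v (Q s.toNNReal ω) i : ENNReal) ∂P := by
  rw [(h.poisson i).lintegral_eval (h.measurable_internalClock t i).aemeasurable
      (h.indepLaterIncrements_internalClock t i),
    lintegral_lintegral_swap (h.measurable_uncurry_rate i).coe_nnreal_ennreal.aemeasurable]
  refine lintegral_congr_ae ?_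
  filter_upwards [h.balance] with ω hω
  exact coe_internalClock (h.monotone_input ω) hω.le t i

theorem lintegral_balance [IsProbabilityMeasure P] (h : IsTimeChangedQueue P g N v Q)
    (t : ℝ≥0) :
    ∫⁻ ω, (Q t ω : ENNReal) ∂P +
        ∫⁻ s in Ico (0 : ℝ) t, ∫⁻ ω, (totalRate v (Q s.toNNReal ω) : ENNReal) ∂P =
      ∫⁻ ω, (g t ω : ENNReal) ∂P := by
  have hrate : ∀ i, Measurable fun p : ℝ × Ω => (v (Q p.1.toNNReal p.2) i : ENNReal) := fun i =>
    (h.measurable_uncurry_rate i).coe_nnreal_ennreal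
  have hcount : ∀ i, AEMeasurable
      (fun ω => (N i (internalClock v (Q · ω) t i) ω : ENNReal)) P := fun i =>
    measurable_from_nat.comp_aemeasurable <|
      (h.poisson i).aemeasurable_eval (h.measurable_internalClock t i).aemeasurable
  have hpresent : Measurable fun ω => (Q t ω : ENNReal) := measurable_from_nat.comp (h.measurable t)
  have hsum : ∫⁻ s in Ico (0 : ℝ) t, ∫⁻ ω, (totalRate v (Q s.toNNReal ω) : ENNReal) ∂P =
      ∑ i, ∫⁻ ω, (N i (internalClock v (Q · ω) t i) ω : ENNReal) ∂P := by
    simp only [totalRate, ENNReal.ofNNReal_finsetSum, h.lintegral_departures]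
    rw [← lintegral_finsetSum _ fun i _ => (hrate i).lintegral_prod_right']
    exact lintegral_congr fun s => lintegral_finsetSum _ fun i _ =>
      (hrate i).comp measurable_prodMk_left
  rw [hsum, ← lintegral_finsetSum' _ fun i _ => hcount i,
    ← lintegral_add_left hpresent]
  refine lintegral_congr_ae ?_
  filter_upwards [h.balance] with ω hω
  exact_mod_cast hω t

theorem integrable_of_input [IsProbabilityMeasure P] (h : IsTimeChangedQueue P g N v Q)
    {t : ℝ≥0} (hg : ∫⁻ ω, (g t ω : ENNReal) ∂P ≠ ⊤) : Integrable (fun ω => (Q t ω : ℝ)) P := by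
  rw [← h.lintegral_balance t, ENNReal.add_ne_top] at hg
  simpa using integrable_toReal_of_lintegral_ne_top
    (measurable_from_nat.comp (h.measurable t)).aemeasurable hg.1

theorem integrable_rate_of_input [IsProbabilityMeasure P] (h : IsTimeChangedQueue P g N v Q)
    {t : ℝ≥0} (hg : ∫⁻ ω, (g t ω : ENNReal) ∂P ≠ ⊤) :
    Integrable (fun p : ℝ × Ω => (totalRate v (Q p.1.toNNReal p.2) : ℝ))
      ((volume.restrict (Ico (0 : ℝ) t)).prod P) := by
  have hrate := h.measurable_uncurry_totalRate.coe_nnreal_ennreal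
  rw [← h.lintegral_balance t, ENNReal.add_ne_top, ← lintegral_prod _ hrate.aemeasurable] at hg
  simpa only [ENNReal.coe_toReal] using
    integrable_toReal_of_lintegral_ne_top hrate.aemeasurable hg.2

theorem intervalIntegrable_rate_of_input [IsProbabilityMeasure P]
    (h : IsTimeChangedQueue P g N v Q) {t : ℝ≥0} (hg : ∫⁻ ω, (g t ω : ENNReal) ∂P ≠ ⊤) :
    IntervalIntegrable (fun s => ∫ ω, (totalRate v (Q s.toNNReal ω) : ℝ) ∂P) volume 0 t :=
  (intervalIntegrable_iff_integrableOn_Ico_of_le t.coe_nonneg).2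
    (h.integrable_rate_of_input hg).integral_prod_left

theorem integral_balance [IsProbabilityMeasure P] (h : IsTimeChangedQueue P g N v Q)
    {t : ℝ≥0} (hg : ∫⁻ ω, (g t ω : ENNReal) ∂P ≠ ⊤) :
    ∫ ω, (Q t ω : ℝ) ∂P + ∫ s in (0 : ℝ)..t, ∫ ω, (totalRate v (Q s.toNNReal ω) : ℝ) ∂P =
      (∫⁻ ω, (g t ω : ENNReal) ∂P).toReal := by
  have hrate := h.measurable_uncurry_totalRate.coe_nnreal_ennreal
  have hpresent : ∫ ω, (Q t ω : ℝ) ∂P = (∫⁻ ω, (Q t ω : ENNReal) ∂P).toReal := by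
    simpa using integral_toReal (f := fun ω => (Q t ω : ENNReal))
      (measurable_from_nat.comp (h.measurable t)).aemeasurable (by simp)
  have hdepart : ∫ s in (0 : ℝ)..t, ∫ ω, (totalRate v (Q s.toNNReal ω) : ℝ) ∂P =
      (∫⁻ s in Ico (0 : ℝ) t, ∫⁻ ω, (totalRate v (Q s.toNNReal ω) : ENNReal) ∂P).toReal := by
    rw [intervalIntegral.integral_of_le t.coe_nonneg, ← restrict_Ico_eq_restrict_Ioc,
      ← integral_prod _ (h.integrable_rate_of_input hg), ← lintegral_prod _ hrate.aemeasurable]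
    simpa only [ENNReal.coe_toReal] using integral_toReal hrate.aemeasurable (by simp)
  have hfin := hg
  rw [← h.lintegral_balance t, ENNReal.add_ne_top] at hfin
  rw [← h.lintegral_balance t, ENNReal.toReal_add hfin.1 hfin.2, hpresent, hdepart]

end IsTimeChangedQueue

end TimeChangedQueue

section Primitive

variable {f : ℝ → ℝ} {s t : ℝ}

theorem continuousOn_Ici_primitive (hf : ∀ t, 0 ≤ t → IntervalIntegrable f volume 0 t) :
    ContinuousOn (fun t => ∫ s in (0 : ℝ)..t, f s) (Ici 0) := by
  intro s (hs : 0 ≤ s)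
  have hcont := intervalIntegral.continuousOn_primitive_interval' (hf (s + 1) (by positivity))
    left_mem_uIcc
  rw [uIcc_of_le (by positivity)] at hcont
  refine (hcont s ⟨hs, by linarith⟩).mono_of_mem_nhdsWithin ?_
  rw [← Ici_inter_Iic]
  exact inter_mem self_mem_nhdsWithin
    (mem_nhdsWithin_of_mem_nhds (Iic_mem_nhds (by linarith)))

theorem primitive_sub_primitive (hf : ∀ t, 0 ≤ t → IntervalIntegrable f volume 0 t)
    (hs : 0 ≤ s) (ht : 0 ≤ t) :
    (∫ u in (0 : ℝ)..t, f u) - ∫ u in (0 : ℝ)..s, f u = ∫ u in s..t, f u :=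
  intervalIntegral.integral_interval_sub_left (hf t ht) (hf s hs)

theorem monotoneOn_Ici_primitive (hf : ∀ t, 0 ≤ t → IntervalIntegrable f volume 0 t)
    (h0 : ∀ s, 0 ≤ s → 0 ≤ f s) : MonotoneOn (fun t => ∫ s in (0 : ℝ)..t, f s) (Ici 0) := by
  intro s (hs : 0 ≤ s) t (ht : 0 ≤ t) hst
  rw [← sub_nonneg, primitive_sub_primitive hf hs ht]
  exact intervalIntegral.integral_nonneg hst fun u hu => h0 u (hs.trans hu.1)

theorem primitive_nonpos_of_nonpos_where_pos
    (hf : ∀ t, 0 ≤ t → IntervalIntegrable f volume 0 t)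
    (h : ∀ s, 0 ≤ s → 0 < ∫ u in (0 : ℝ)..s, f u → f s ≤ 0) (ht : 0 ≤ t) :
    ∫ u in (0 : ℝ)..t, f u ≤ 0 := by
  set D : ℝ → ℝ := fun t => ∫ u in (0 : ℝ)..t, f u
  by_contra! hpos
  have hcont : ContinuousOn D (Icc 0 t) := (continuousOn_Ici_primitive hf).mono Icc_subset_Ici_self
  have hcompact : IsCompact (Icc 0 t ∩ D ⁻¹' Iic 0) :=
    isCompact_Icc.of_isClosed_subset
      (hcont.preimage_isClosed_of_isClosed isClosed_Icc isClosed_Iic) inter_subset_left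
  obtain ⟨s, ⟨⟨hs, hst⟩, hDs⟩, hlast⟩ := hcompact.exists_isGreatest
    ⟨0, ⟨le_rfl, ht⟩, by simp [D]⟩
  have hafter : ∀ u ∈ Ioc s t, 0 < D u := fun u hu => by
    by_contra! hDu
    exact hu.1.not_ge (hlast ⟨⟨hs.trans hu.1.le, hu.2⟩, hDu⟩)
  have hincrement : D t - D s ≤ 0 := by
    rw [primitive_sub_primitive hf hs ht, intervalIntegral.integral_of_le hst]
    exact setIntegral_nonpos measurableSet_Ioc fun u hu =>
      h u (hs.trans hu.1.le) (hafter u hu)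
  exact hpos.not_ge ((sub_nonpos.1 hincrement).trans hDs)

theorem le_of_integral_equations {lam u v U V : ℝ → ℝ}
    (hlam : ∀ t, 0 ≤ t → IntervalIntegrable lam volume 0 t)
    (hU : ∀ t, 0 ≤ t → IntervalIntegrable U volume 0 t)
    (hV : ∀ t, 0 ≤ t → IntervalIntegrable V volume 0 t)
    (hu : ∀ t, 0 ≤ t → u t = u 0 + ∫ s in (0 : ℝ)..t, (lam s - U s))
    (hv : ∀ t, 0 ≤ t → v t = v 0 + ∫ s in (0 : ℝ)..t, (lam s - V s))
    (h0 : u 0 = v 0) (h : ∀ s, 0 ≤ s → v s < u s → V s ≤ U s) (ht : 0 ≤ t) : u t ≤ v t := by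
  have hdiff : ∀ t, 0 ≤ t → u t - v t = ∫ s in (0 : ℝ)..t, (V s - U s) := fun t ht => by
    rw [hu t ht, hv t ht, h0, intervalIntegral.integral_sub (hlam t ht) (hU t ht),
      intervalIntegral.integral_sub (hlam t ht) (hV t ht),
      intervalIntegral.integral_sub (hV t ht) (hU t ht)]
    ring
  rw [← sub_nonpos, hdiff t ht]
  refine primitive_nonpos_of_nonpos_where_pos (fun t ht => (hV t ht).sub (hU t ht))
    (fun s hs hpos => ?_) ht
  rw [← hdiff s hs] at hpos
  exact sub_nonpos.2 (h s hs (sub_pos.1 hpos))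

end Primitive

section DepartureRate

variable {μ θ : ℝ} {c : ℕ}

/-- The total rate of services and abandonments at the queue length `x`. -/
noncomputable def departureRate (c : ℕ) (μ θ x : ℝ) : ℝ :=
  μ * min x c + θ * max (x - c) 0

theorem continuous_departureRate : Continuous (departureRate c μ θ) := by
  unfold departureRate
  fun_prop

theorem monotone_departureRate (hμ : 0 ≤ μ) (hθ : 0 ≤ θ) : Monotone (departureRate c μ θ) :=
  fun x y hxy => by
    unfold departureRate
    gcongr

theorem departureRate_eq_sub (x : ℝ) :
    departureRate c μ θ x = μ * x - (μ - θ) * max (x - c) 0 := by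
  have hmin : min x (c : ℝ) = x - max (x - c) 0 := by grind
  rw [departureRate, hmin]
  ring

theorem convexOn_max_sub_zero (a : ℝ) : ConvexOn ℝ univ fun x : ℝ => max (x - a) 0 :=
  ((convexOn_id convex_univ).sub (concaveOn_const a convex_univ)).sup (convexOn_const 0 convex_univ)

theorem concaveOn_departureRate (h : θ ≤ μ) : ConcaveOn ℝ univ (departureRate c μ θ) := by
  rw [funext departureRate_eq_sub]
  exact (LinearMap.concaveOn (LinearMap.mul ℝ ℝ μ) convex_univ).sub
    ((convexOn_max_sub_zero c).smul (sub_nonneg.2 h))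

theorem convexOn_departureRate (h : μ ≤ θ) : ConvexOn ℝ univ (departureRate c μ θ) := by
  have heq : departureRate c μ θ = fun x : ℝ => μ * x + (θ - μ) * max (x - c) 0 :=
    funext fun x => by rw [departureRate_eq_sub]; ring
  rw [heq]
  exact (LinearMap.convexOn (LinearMap.mul ℝ ℝ μ) convex_univ).add
    ((convexOn_max_sub_zero c).smul (sub_nonneg.2 h))

variable {Ω : Type*} [MeasurableSpace Ω] {P : Measure Ω} [IsProbabilityMeasure P] {X : Ω → ℝ}

theorem integrable_departureRate (hX : Integrable X P) :
    Integrable (fun ω => departureRate c μ θ (X ω)) P :=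
  ((hX.inf (integrable_const _)).const_mul μ).add
    ((hX.sub (integrable_const _)).pos_part.const_mul θ)

theorem integral_departureRate_le (hX : Integrable X P) (h : θ ≤ μ) :
    ∫ ω, departureRate c μ θ (X ω) ∂P ≤ departureRate c μ θ (∫ ω, X ω ∂P) :=
  (concaveOn_departureRate h).le_map_integral continuous_departureRate.continuousOn isClosed_univ
    (.of_forall fun _ => mem_univ _) hX (integrable_departureRate hX)

theorem le_integral_departureRate (hX : Integrable X P) (h : μ ≤ θ) :
    departureRate c μ θ (∫ ω, X ω ∂P) ≤ ∫ ω, departureRate c μ θ (X ω) ∂P :=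
  (convexOn_departureRate h).map_integral_le continuous_departureRate.continuousOn isClosed_univ
    (.of_forall fun _ => mem_univ _) hX (integrable_departureRate hX)

end DepartureRate

section CumulativeIntensity

variable {lam : ℝ → ℝ}

/-- The expected number `∫₀ᵗ lam s ds` of arrivals up to the time `t`. -/
noncomputable def cumulativeIntensity (lam : ℝ → ℝ) (t : ℝ≥0) : ℝ≥0 :=
  (∫ s in (0 : ℝ)..t, lam s).toNNReal

theorem coe_cumulativeIntensity (hlam : ∀ t, 0 ≤ t → 0 ≤ lam t) (t : ℝ≥0) :
    (cumulativeIntensity lam t : ℝ) = ∫ s in (0 : ℝ)..t, lam s :=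
  Real.coe_toNNReal _ (intervalIntegral.integral_nonneg t.coe_nonneg fun _ h => hlam _ h.1)

theorem monotone_cumulativeIntensity (hlam : ∀ t, 0 ≤ t → 0 ≤ lam t)
    (hlam_int : ∀ t, 0 ≤ t → IntervalIntegrable lam volume 0 t) :
    Monotone (cumulativeIntensity lam) := fun s t hst =>
  Real.toNNReal_le_toNNReal (monotoneOn_Ici_primitive hlam_int hlam s.coe_nonneg t.coe_nonneg hst)

theorem continuous_cumulativeIntensity
    (hlam_int : ∀ t, 0 ≤ t → IntervalIntegrable lam volume 0 t) :
    Continuous (cumulativeIntensity lam) :=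
  continuous_real_toNNReal.comp ((continuousOn_Ici_primitive hlam_int).comp_continuous
    NNReal.continuous_coe fun t => t.coe_nonneg)

end CumulativeIntensity

section ErlangA

variable {c : ℕ}

/-- The rates of services (`0`) and of abandonments (`1`) in the Erlang-A queue. -/
def erlangRate (c : ℕ) (μ θ : ℝ≥0) (x : ℕ) : Fin 2 → ℝ≥0 :=
  ![μ * min (x : ℝ≥0) c, θ * ((x : ℝ≥0) - c)]

theorem coe_totalRate_erlangRate (μ θ : ℝ≥0) (x : ℕ) :
    (totalRate (erlangRate c μ θ) x : ℝ) = departureRate c μ θ x := by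
  simp [totalRate, erlangRate, departureRate, NNReal.coe_sub_def]

variable {Ω : Type*} [MeasurableSpace Ω] {P : Measure Ω} {lam : ℝ → ℝ} {Q : ℝ≥0 → Ω → ℕ}

theorem integral_totalRate_erlangRate_congr {μ θ : ℝ≥0} {Q' : ℝ≥0 → Ω → ℕ}
    (hQ' : ∀ᵐ ω ∂P, ∀ t, Q' t ω = Q t ω) (t : ℝ≥0) :
    ∫ ω, (totalRate (erlangRate c μ θ) (Q' t ω) : ℝ) ∂P =
      ∫ ω, departureRate c μ θ (Q t ω) ∂P := by
  refine integral_congr_ae ?_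
  filter_upwards [hQ'] with ω hω
  rw [hω, coe_totalRate_erlangRate]

theorem solvesBalance_erlangRate {g q : ℝ≥0 → ℕ} {n : Fin 2 → ℝ≥0 → ℕ} {μ θ : ℝ≥0}
    (hq : RightContinuous q)
    (h : ∀ t : ℝ≥0, (q t : ℝ) = g t
      - n 0 (∫ s in (0 : ℝ)..t, (μ : ℝ) * min (q s.toNNReal : ℝ) c).toNNReal
      - n 1 (∫ s in (0 : ℝ)..t, (θ : ℝ) * max ((q s.toNNReal : ℝ) - c) 0).toNNReal) :
    SolvesBalance g n (erlangRate c μ θ) q := fun t => by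
  have hclock := toNNReal_integral_eq_internalClock (v := erlangRate c μ θ) hq t
  have hservice := hclock 0
  have habandon := hclock 1
  simp only [erlangRate, Matrix.cons_val_zero, Matrix.cons_val_one, NNReal.coe_mul, NNReal.coe_min,
    NNReal.coe_sub_def, NNReal.coe_natCast] at hservice habandon
  have ht := h t
  rw [hservice, habandon] at ht
  rw [Fin.sum_univ_two, ← Nat.cast_inj (R := ℝ)]
  push_cast
  linarith!

theorem indepFun_arrivals_departures {Q₀ : Ω → ℕ} {N : Fin 3 → ℝ≥0 → Ω → ℕ}
    [IsProbabilityMeasure P]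
    (hQ₀ : Measurable Q₀) (hN : ∀ i t, Measurable (N i t))
    (hind : iIndepFun (fun i ω t => N i t ω) P)
    (hQind : IndepFun Q₀ (fun ω i t => N i t ω) P) (L : ℝ≥0 → ℝ≥0) :
    IndepFun (fun ω t => Q₀ ω + N 0 (L t) ω) (fun ω (i : Fin 2) t => N i.succ t ω) P := by
  have hpaths : ∀ i, Measurable fun ω t => N i t ω := fun i => measurable_pi_lambda _ (hN i)
  have hstreams : IndepFun (fun ω t => N 0 t ω) (fun ω (i : Fin 2) t => N i.succ t ω) P :=
    (hind.indepFun_finset {0} {1, 2} (by decide) hpaths).comp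
      (φ := fun n : ({0} : Finset (Fin 3)) → ℝ≥0 → ℕ => n ⟨0, by simp⟩)
      (ψ := fun (n : ({1, 2} : Finset (Fin 3)) → ℝ≥0 → ℕ) (i : Fin 2) =>
        n ⟨i.succ, by fin_cases i <;> simp⟩) (by fun_prop) (by fun_prop)
  have hpair := indepFun_prodMk_left_of_prodMk_right hQ₀ (hpaths 0)
    (measurable_pi_lambda _ fun i : Fin 2 => hpaths i.succ)
    (hQind.comp (φ := id) (ψ := fun n : Fin 3 → ℝ≥0 → ℕ => (n 0, fun i : Fin 2 => n i.succ))
      measurable_id (by fun_prop)) hstreams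
  exact hpair.comp (φ := fun (p : ℕ × (ℝ≥0 → ℕ)) t => p.1 + p.2 (L t)) (ψ := id)
    (by fun_prop) measurable_id

theorem lintegral_natCast_eq_ofReal_integral {X : Ω → ℕ}
    (hX : Integrable (fun ω => (X ω : ℝ)) P) :
    ∫⁻ ω, (X ω : ENNReal) ∂P = ENNReal.ofReal (∫ ω, (X ω : ℝ) ∂P) := by
  rw [ofReal_integral_eq_lintegral_ofReal hX (.of_forall fun ω => (X ω).cast_nonneg)]
  simp only [ENNReal.ofReal_natCast]

theorem lintegral_initial_add_arrivals (hQ₀ : Measurable (Q 0))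
    (hQ₀_int : Integrable (fun ω => (Q 0 ω : ℝ)) P) {N : ℝ≥0 → Ω → ℕ}
    (hN : IsStandardPoissonProcess P N) (hlam : ∀ t, 0 ≤ t → 0 ≤ lam t) (t : ℝ≥0) :
    ∫⁻ ω, ((Q 0 ω + N (cumulativeIntensity lam t) ω : ℕ) : ENNReal) ∂P =
      ENNReal.ofReal (∫ ω, (Q 0 ω : ℝ) ∂P + ∫ s in (0 : ℝ)..t, lam s) := by
  simp only [Nat.cast_add]
  rw [lintegral_add_left (f := fun ω => (Q 0 ω : ENNReal)) (measurable_from_nat.comp hQ₀),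
    hN.lintegral_eval_const, lintegral_natCast_eq_ofReal_integral hQ₀_int,
    ← coe_cumulativeIntensity hlam,
    ENNReal.ofReal_add (integral_nonneg fun ω => (Q 0 ω).cast_nonneg) NNReal.zero_le_coe,
    ENNReal.ofReal_coe_nnreal]

namespace IsErlangAQueue

variable [IsProbabilityMeasure P] {μ θ : ℝ≥0}

theorem exists_isTimeChangedQueue (hQ : IsErlangAQueue P lam c μ θ Q)
    (hlam : ∀ t, 0 ≤ t → 0 ≤ lam t) (hlam_int : ∀ t, 0 ≤ t → IntervalIntegrable lam volume 0 t)
    (hQ₀ : Integrable (fun ω => (Q 0 ω : ℝ)) P) :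
    ∃ (g : ℝ≥0 → Ω → ℕ) (N : Fin 2 → ℝ≥0 → Ω → ℕ) (Q' : ℝ≥0 → Ω → ℕ),
      (∀ t : ℝ≥0, ∫⁻ ω, (g t ω : ENNReal) ∂P =
        ENNReal.ofReal (∫ ω, (Q 0 ω : ℝ) ∂P + ∫ s in (0 : ℝ)..t, lam s)) ∧
      (∀ᵐ ω ∂P, ∀ t, Q' t ω = Q t ω) ∧ IsTimeChangedQueue P g N (erlangRate c μ θ) Q' := by
  obtain ⟨N, hN, hind, hQind, heq⟩ := hQ.timeChange
  obtain ⟨Q', hQ'm, hQ'right, hQ'⟩ := exists_rightContinuous_modification hQ.measurable hQ.rightCts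
  have hcum := monotone_cumulativeIntensity hlam hlam_int
  let g : ℝ≥0 → Ω → ℕ := fun t ω => Q 0 ω + N 0 (cumulativeIntensity lam t) ω
  have hgright : ∀ ω, RightContinuous (g · ω) := fun ω =>
    (((hN 0).rightContinuous ω).comp (continuous_cumulativeIntensity hlam_int) hcum).map
      (F := (Q 0 ω + ·)) continuous_of_discreteTopology
  have hbalance : ∀ᵐ ω ∂P,
      SolvesBalance (g · ω) (fun i : Fin 2 => (N i.succ · ω)) (erlangRate c μ θ) (Q' · ω) := by
    filter_upwards [hQ', heq] with ω hω hωeq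
    refine solvesBalance_erlangRate (hQ'right ω) fun t => ?_
    simpa only [hω, g, cumulativeIntensity, Nat.cast_add, Fin.succ_zero_eq_one,
      Fin.succ_one_eq_two] using hωeq t
  refine ⟨g, fun i => N i.succ, Q',
    lintegral_initial_add_arrivals (hQ.measurable 0) hQ₀ (hN 0) hlam, hQ', ?_⟩
  exact
    { poisson := fun i => hN i.succ
      iIndepFun_streams := hind.precomp (Fin.succ_injective 2)
      measurable_input := fun t => (hQ.measurable 0).add ((hN 0).measurable _)
      monotone_input := fun ω _ _ hst => Nat.add_le_add_left ((hN 0).mono ω (hcum hst)) _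
      rightContinuous_input := hgright
      indepFun_input := indepFun_arrivals_departures (hQ.measurable 0)
        (fun i => (hN i).measurable) hind hQind _
      measurable := hQ'm
      rightContinuous := hQ'right
      balance := hbalance }

theorem integrable (hQ : IsErlangAQueue P lam c μ θ Q) (hlam : ∀ t, 0 ≤ t → 0 ≤ lam t)
    (hlam_int : ∀ t, 0 ≤ t → IntervalIntegrable lam volume 0 t)
    (hQ₀ : Integrable (fun ω => (Q 0 ω : ℝ)) P) (t : ℝ≥0) :
    Integrable (fun ω => (Q t ω : ℝ)) P := by
  obtain ⟨g, N, Q', hg, hQ', h⟩ := hQ.exists_isTimeChangedQueue hlam hlam_int hQ₀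
  refine (h.integrable_of_input (t := t) (by simp [hg])).congr ?_
  filter_upwards [hQ'] with ω hω
  rw [hω]

theorem intervalIntegrable_integral_departureRate (hQ : IsErlangAQueue P lam c μ θ Q)
    (hlam : ∀ t, 0 ≤ t → 0 ≤ lam t) (hlam_int : ∀ t, 0 ≤ t → IntervalIntegrable lam volume 0 t)
    (hQ₀ : Integrable (fun ω => (Q 0 ω : ℝ)) P) (t : ℝ) (ht : 0 ≤ t) :
    IntervalIntegrable (fun s => ∫ ω, departureRate c μ θ (Q s.toNNReal ω) ∂P) volume 0 t := by
  lift t to ℝ≥0 using ht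
  obtain ⟨g, N, Q', hg, hQ', h⟩ := hQ.exists_isTimeChangedQueue hlam hlam_int hQ₀
  simpa only [integral_totalRate_erlangRate_congr hQ'] using
    h.intervalIntegrable_rate_of_input (t := t) (by simp [hg])

theorem integral_eq (hQ : IsErlangAQueue P lam c μ θ Q)
    (hlam : ∀ t, 0 ≤ t → 0 ≤ lam t) (hlam_int : ∀ t, 0 ≤ t → IntervalIntegrable lam volume 0 t)
    (hQ₀ : Integrable (fun ω => (Q 0 ω : ℝ)) P) (t : ℝ) (ht : 0 ≤ t) :
    ∫ ω, (Q t.toNNReal ω : ℝ) ∂P = ∫ ω, (Q 0 ω : ℝ) ∂P +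
      ∫ s in (0 : ℝ)..t, (lam s - ∫ ω, departureRate c μ θ (Q s.toNNReal ω) ∂P) := by
  rw [intervalIntegral.integral_sub (hlam_int t ht)
    (hQ.intervalIntegrable_integral_departureRate hlam hlam_int hQ₀ t ht)]
  lift t to ℝ≥0 using ht
  obtain ⟨g, N, Q', hg, hQ', h⟩ := hQ.exists_isTimeChangedQueue hlam hlam_int hQ₀
  have hmean : ∫ ω, (Q' t ω : ℝ) ∂P = ∫ ω, (Q t ω : ℝ) ∂P :=
    integral_congr_ae (hQ'.mono fun ω hω => by simp only [hω])
  have harrive : 0 ≤ ∫ s in (0 : ℝ)..t, lam s :=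
    intervalIntegral.integral_nonneg t.coe_nonneg fun s hs => hlam s hs.1
  have hbalance := h.integral_balance (t := t) (by simp [hg])
  simp only [hmean, integral_totalRate_erlangRate_congr hQ'] at hbalance
  rw [hg, ENNReal.toReal_ofReal (add_nonneg (integral_nonneg fun ω => (Q 0 ω).cast_nonneg) harrive)]
    at hbalance
  rw [Real.toNNReal_coe]
  linarith

end IsErlangAQueue

namespace IsFluidMean

variable {q : ℝ → ℝ}

theorem intervalIntegrable_departureRate {μ θ : ℝ} (hq : IsFluidMean lam c μ θ q) (t : ℝ)
    (ht : 0 ≤ t) : IntervalIntegrable (fun s => departureRate c μ θ (q s)) volume 0 t :=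
  (continuous_departureRate.comp_continuousOn <| hq.continuousOn.mono <| by
    rw [uIcc_of_le ht]
    exact Icc_subset_Ici_self).intervalIntegrable

theorem eq_integral {μ θ : ℝ} (hq : IsFluidMean lam c μ θ q) (t : ℝ) (ht : 0 ≤ t) :
    q t = q 0 + ∫ s in (0 : ℝ)..t, (lam s - departureRate c μ θ (q s)) := by
  simpa only [departureRate, sub_sub] using hq.integralEq t ht

variable [IsProbabilityMeasure P] {μ θ : ℝ≥0}

theorem le_integral_queue (hq : IsFluidMean lam c μ θ q) (hQ : IsErlangAQueue P lam c μ θ Q)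
    (hlam : ∀ t, 0 ≤ t → 0 ≤ lam t) (hlam_int : ∀ t, 0 ≤ t → IntervalIntegrable lam volume 0 t)
    (hQ₀ : Integrable (fun ω => (Q 0 ω : ℝ)) P) (h0 : q 0 = ∫ ω, (Q 0 ω : ℝ) ∂P) (h : θ ≤ μ)
    (t : ℝ≥0) : q t ≤ ∫ ω, (Q t ω : ℝ) ∂P := by
  simpa only [Real.toNNReal_coe] using le_of_integral_equations
    (v := fun s => ∫ ω, (Q s.toNNReal ω : ℝ) ∂P) hlam_int
    hq.intervalIntegrable_departureRate
    (hQ.intervalIntegrable_integral_departureRate hlam hlam_int hQ₀)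
    hq.eq_integral (by simpa using hQ.integral_eq hlam hlam_int hQ₀) (by simpa using h0)
    (fun s _ hs => (integral_departureRate_le (hQ.integrable hlam hlam_int hQ₀ _) h).trans
      (monotone_departureRate μ.coe_nonneg θ.coe_nonneg hs.le)) t.coe_nonneg

theorem integral_queue_le (hq : IsFluidMean lam c μ θ q) (hQ : IsErlangAQueue P lam c μ θ Q)
    (hlam : ∀ t, 0 ≤ t → 0 ≤ lam t) (hlam_int : ∀ t, 0 ≤ t → IntervalIntegrable lam volume 0 t)
    (hQ₀ : Integrable (fun ω => (Q 0 ω : ℝ)) P) (h0 : q 0 = ∫ ω, (Q 0 ω : ℝ) ∂P) (h : μ ≤ θ)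
    (t : ℝ≥0) : ∫ ω, (Q t ω : ℝ) ∂P ≤ q t := by
  simpa only [Real.toNNReal_coe] using le_of_integral_equations
    (u := fun s => ∫ ω, (Q s.toNNReal ω : ℝ) ∂P) hlam_int
    (hQ.intervalIntegrable_integral_departureRate hlam hlam_int hQ₀)
    hq.intervalIntegrable_departureRate
    (by simpa using hQ.integral_eq hlam hlam_int hQ₀) hq.eq_integral (by simpa using h0.symm)
    (fun s _ hs => (monotone_departureRate μ.coe_nonneg θ.coe_nonneg hs.le).trans
      (le_integral_departureRate (hQ.integrable hlam hlam_int hQ₀ _) h)) t.coe_nonneg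

end IsFluidMean

end ErlangA

theorem theorem1 {Ω : Type*} [MeasurableSpace Ω] (P : Measure Ω) [IsProbabilityMeasure P]
    (lam : ℝ → ℝ) (hlam : ∀ t : ℝ, 0 ≤ t → 0 ≤ lam t)
    (hlam_int : ∀ t : ℝ, 0 ≤ t → IntervalIntegrable lam volume 0 t)
    (c : ℕ) (hc : 0 < c) (μ θ : ℝ) (hμ : 0 < μ) (hθ : 0 ≤ θ)
    (Q : ℝ≥0 → Ω → ℕ) (hQ : IsErlangAQueue P lam c μ θ Q)
    (hQ0 : Integrable (fun ω => (Q 0 ω : ℝ)) P)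
    (q : ℝ → ℝ) (hq : IsFluidMean lam c μ θ q)
    (h0 : q 0 = ∫ ω, (Q 0 ω : ℝ) ∂P) :
    (∀ t : ℝ≥0, Integrable (fun ω => (Q t ω : ℝ)) P) ∧
    (θ < μ → ∀ t : ℝ≥0, q t ≤ ∫ ω, (Q t ω : ℝ) ∂P) ∧
    (μ < θ → ∀ t : ℝ≥0, ∫ ω, (Q t ω : ℝ) ∂P ≤ q t) ∧
    (θ = μ → ∀ t : ℝ≥0, ∫ ω, (Q t ω : ℝ) ∂P = q t) := by
  lift μ to ℝ≥0 using hμ.le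
  lift θ to ℝ≥0 using hθ
  have hlower := hq.le_integral_queue hQ hlam hlam_int hQ0 h0
  have hupper := hq.integral_queue_le hQ hlam hlam_int hQ0 h0
  refine ⟨hQ.integrable hlam hlam_int hQ0, fun h => hlower (by exact_mod_cast h.le),
    fun h => hupper (by exact_mod_cast h.le), fun h t => ?_⟩
  have heq : θ = μ := by exact_mod_cast h
  exact le_antisymm (hupper heq.ge t) (hlower heq.le t)
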